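/- Let $0<\alpha\le 1$ and $0<\beta\le 1$. For $s>0$ let $D^{\alpha}f(s)=\lim_{\varepsilon\to0}\frac{f(s+\varepsilon s^{1-\alpha})-f(s)}{\varepsilon}$ be the conformable derivative, and consider on $t>0$, $x>0$ the fractional mKdV equation $$\Delta:=u_t^{(\beta)}-6u^2u_x^{(\alpha)}+u_x^{(3\alpha)}=0,$$ where $u_t^{(\beta)}$ and $u_x^{(\alpha)}$ are the conformable partial derivatives of $u(t,x)$ and $u_x^{(3\alpha)}$ is the sequential derivative $\partial_x^{\alpha}\partial_x^{\alpha}\partial_x^{\alpha}u$. Let $V=\tau\,\partial_t+\xi\,\partial_x+\eta\,\partial_u$ be a smooth vector field on $M=\{(t,x,u): t>0,\ x>0\}$. The following are equivalent: (a) $V$ generates a local one-parameter group of point transformations of $M$ that carries (graphs of) smooth local solutions of the equation to solutions; (b) $V$ satisfies the infinitesimal Lie symmetry condition: $-12\,\eta\,u\,u_x^{(\alpha)}+\eta^t_\beta-6u^2\eta^x_\alpha+\eta^{xxx}_\alpha=0$ at every jet with $t,x>0$ and $\Delta=0$. Here $\eta^t_\beta,\eta^x_\alpha,\eta^{xxx}_\alpha$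 are the coefficients of the prolongation of $V$ for $u_t^{(\beta)},u_x^{(\alpha)},u_x^{(3\alpha)}$: with $\eta^t=D_t\eta-u_xD_t\xi-u_tD_t\tau$, $\eta^x=D_x\eta-u_xD_x\xi-u_tD_x\tau$, $\eta^{xx}=D_x\eta^x-u_{xx}D_x\xi-u_{xt}D_x\tau$, $\eta^{xxx}=D_x\eta^{xx}-u_{xxx}D_x\xi-u_{xxt}D_x\tau$, $$\eta^t_\beta=t^{1-\beta}\eta^t+(1-\beta)\tau t^{-\beta}u_t,\qquad \eta^x_\alpha=x^{1-\alpha}\eta^x+(1-\alpha)\xi x^{-\alpha}u_x,$$ $$\begin{aligned}\eta^{xxx}_\alpha={}&x^{3-3\alpha}\eta^{xxx}+(3-3\alpha)x^{2-3\alpha}\eta^{xx}+(1-\alpha)(1-2\alpha)x^{1-3\alpha}\eta^x+(3-3\alpha)\xi x^{2-3\alpha}u_{xxx}\\&+(3-3\alpha)(2-3\alpha)\xi x^{1-3\alpha}u_{xx}+(1-\alpha)(1-2\alpha)(1-3\alpha)\xi x^{-3\alpha}u_x;\end{aligned}$$ (c) there are constants $c_1,c_2,c_3\in\mathbb R$ such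 that on $M$ $$\tau=-\frac{3c_1}{\beta}t+c_2t^{1-\beta},\qquad \xi=-\frac{c_1}{\alpha}x+c_3x^{1-\alpha},\qquad \eta=c_1u.$$ Consequently the generators of symmetries on $M$ are exactly the real span of the three linearly independent vector fields $$V_1=t^{1-\beta}\partial_t,\qquad V_2=x^{1-\alpha}\partial_x,\qquad V_3=\frac{3t}{\beta}\partial_t+\frac{x}{\alpha}\partial_x-u\,\partial_u,$$ which satisfy on $M$ the bracket relations $[V_1,V_2]=0$, $[V_1,V_3]=3V_1$, $[V_2,V_3]=V_2$. When $\alpha=\beta=1$, the equation is the classical mKdV equation $u_t-6u^2u_x+u_{xxx}=0$ and the three fields are the classical ones $\partial_t$, $\partial_x$, $3t\,\partial_t+x\,\partial_x-u\,\partial_u$. -/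

import Mathlib

open scoped ContDiff

noncomputable section

namespace FracMKdV

/-- The space `ℝ³` of points `(t, x, u)`. A vector field
`τ ∂/∂t + ξ ∂/∂x + η ∂/∂u` is a map `Pt → Pt`, `p ↦ (τ p, ξ p, η p)`. -/
abbrev Pt : Type := ℝ × ℝ × ℝ

/-- The open quadrant `t > 0`, `x > 0` of the independent variables `(t, x)`. -/
def quadrant : Set (ℝ × ℝ) := {p | 0 < p.1 ∧ 0 < p.2}

/-- The points `(t, x, u)` with `t > 0`, `x > 0` and `u` arbitrary. -/
def dom : Set Pt := {p | 0 < p.1 ∧ 0 < p.2.1}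

/-! ### Conformable derivatives and the equation -/

/-- The conformable derivative of order `α` of `f` at `s > 0`: the limit as `ε → 0` of
`(f (s + ε s ^ (1 - α)) - f s) / ε`, that is, the derivative at `ε = 0` of
`ε ↦ f (s + ε s ^ (1 - α))`. -/
def conformableDeriv (α : ℝ) (f : ℝ → ℝ) (s : ℝ) : ℝ :=
  deriv (fun ε : ℝ => f (s + ε * s ^ (1 - α))) 0

/-- The conformable partial derivative of order `β` in `t`. -/
def fracT (β : ℝ) (u : ℝ × ℝ → ℝ) (p : ℝ × ℝ) : ℝ :=
  conformableDeriv β (fun t => u (t, p.2)) p.1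

/-- The conformable partial derivative of order `α` in `x`. -/
def fracX (α : ℝ) (u : ℝ × ℝ → ℝ) (p : ℝ × ℝ) : ℝ :=
  conformableDeriv α (fun x => u (p.1, x)) p.2

/-- The left-hand side `u_t^{(β)} - 6 u² u_x^{(α)} + u_x^{(3α)}` of the fractional mKdV equation,
where `u_x^{(3α)}` is the sequential derivative (three successive derivatives of order `α`). -/
def mkdvOp (α β : ℝ) (u : ℝ × ℝ → ℝ) (p : ℝ × ℝ) : ℝ :=
  fracT β u p - 6 * u p ^ 2 * fracX α u p + fracX α (fracX α (fracX α u)) p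

/-- `u` is a smooth solution of the fractional mKdV equation on the open set `W` of the
quadrant. -/
structure IsSolutionOn (α β : ℝ) (u : ℝ × ℝ → ℝ) (W : Set (ℝ × ℝ)) : Prop where
  isOpen : IsOpen W
  subset : W ⊆ quadrant
  smooth : ContDiffOn ℝ ∞ u W
  eqn : ∀ p ∈ W, mkdvOp α β u p = 0

/-! ### Symmetry groups -/

/-- `Φ`, with domain `D`, is a local one-parameter group of transformations of `dom` generated by
the vector field `V`: `D` is an open neighbourhood of `{0} × dom` in `ℝ × dom` whose slices are
intervals, and `ε ↦ Φ ε p` solves the Lie equations `dp̂/dε = V(p̂)` with `p̂ = p` at `ε = 0`. -/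
structure IsLocalFlow (V : Pt → Pt) (D : Set (ℝ × Pt)) (Φ : ℝ → Pt → Pt) : Prop where
  isOpen : IsOpen D
  subset : ∀ ε p, (ε, p) ∈ D → p ∈ dom
  zero_mem : ∀ p ∈ dom, ((0 : ℝ), p) ∈ D
  interval : ∀ p, {ε : ℝ | (ε, p) ∈ D}.OrdConnected
  mapsTo : ∀ ε p, (ε, p) ∈ D → Φ ε p ∈ dom
  smooth : ContDiffOn ℝ ∞ (fun z : ℝ × Pt => Φ z.1 z.2) D
  init : ∀ p ∈ dom, Φ 0 p = p
  ode : ∀ ε p, (ε, p) ∈ D → HasDerivAt (fun δ : ℝ => Φ δ p) (V (Φ ε p)) ε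

/-- `V` generates a local one-parameter group of symmetries of the fractional mKdV equation: the
transformations of the group carry solutions to solutions. That is, if `u` is a solution on `W`
and the graph of the smooth function `u'` over the open set `W'` is contained in the image under
`Φ ε` of the graph of `u` over `W`, then `u'` is a solution on `W'`. -/
def GeneratesSymmetry (α β : ℝ) (V : Pt → Pt) : Prop :=
  ∃ (D : Set (ℝ × Pt)) (Φ : ℝ → Pt → Pt), IsLocalFlow V D Φ ∧
    ∀ (ε : ℝ) (u u' : ℝ × ℝ → ℝ) (W W' : Set (ℝ × ℝ)),
      IsSolutionOn α β u W → IsOpen W' → ContDiffOn ℝ ∞ u' W' →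
      (∀ q ∈ W', ∃ p ∈ W, (ε, (p.1, p.2, u p)) ∈ D ∧
        Φ ε (p.1, p.2, u p) = (q.1, q.2, u' q)) →
      IsSolutionOn α β u' W'

/-! ### The infinitesimal criterion

A function on a jet space is evaluated on the jets of a smooth function `u (t, x)`; the total
derivatives `D_t` and `D_x` then become the partial derivatives in `t` and `x` of the resulting
function of `(t, x)`. As `u` varies over all smooth functions, its jets at a point take all
values. -/

/-- The ordinary partial derivative in `t`. -/
def pt (f : ℝ × ℝ → ℝ) (p : ℝ × ℝ) : ℝ := deriv (fun t => f (t, p.2)) p.1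

/-- The ordinary partial derivative in `x`. -/
def px (f : ℝ × ℝ → ℝ) (p : ℝ × ℝ) : ℝ := deriv (fun x => f (p.1, x)) p.2

/-- The coefficient `τ` of `V` along `u`. -/
def tau (V : Pt → Pt) (u : ℝ × ℝ → ℝ) (p : ℝ × ℝ) : ℝ := (V (p.1, p.2, u p)).1

/-- The coefficient `ξ` of `V` along `u`. -/
def xi (V : Pt → Pt) (u : ℝ × ℝ → ℝ) (p : ℝ × ℝ) : ℝ := (V (p.1, p.2, u p)).2.1

/-- The coefficient `η` of `V` along `u`. -/
def eta (V : Pt → Pt) (u : ℝ × ℝ → ℝ) (p : ℝ × ℝ) : ℝ := (V (p.1, p.2, u p)).2.2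

/-- `η^t = D_t η - u_x D_t ξ - u_t D_t τ`. -/
def etaT (V : Pt → Pt) (u : ℝ × ℝ → ℝ) (p : ℝ × ℝ) : ℝ :=
  pt (eta V u) p - px u p * pt (xi V u) p - pt u p * pt (tau V u) p

/-- `η^x = D_x η - u_x D_x ξ - u_t D_x τ`. -/
def etaX (V : Pt → Pt) (u : ℝ × ℝ → ℝ) (p : ℝ × ℝ) : ℝ :=
  px (eta V u) p - px u p * px (xi V u) p - pt u p * px (tau V u) p

/-- `η^xx = D_x η^x - u_xx D_x ξ - u_xt D_x τ`. -/
def etaXX (V : Pt → Pt) (u : ℝ × ℝ → ℝ) (p : ℝ × ℝ) : ℝ :=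
  px (etaX V u) p - px (px u) p * px (xi V u) p - px (pt u) p * px (tau V u) p

/-- `η^xxx = D_x η^xx - u_xxx D_x ξ - u_xxt D_x τ`. -/
def etaXXX (V : Pt → Pt) (u : ℝ × ℝ → ℝ) (p : ℝ × ℝ) : ℝ :=
  px (etaXX V u) p - px (px (px u)) p * px (xi V u) p - px (px (pt u)) p * px (tau V u) p

/-- The coefficient of the prolongation of `V` for the variable `u_t^{(β)}`. -/
def etaFracT (β : ℝ) (V : Pt → Pt) (u : ℝ × ℝ → ℝ) (p : ℝ × ℝ) : ℝ :=
  p.1 ^ (1 - β) * etaT V u p + (1 - β) * tau V u p * p.1 ^ (-β) * pt u p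

/-- The coefficient of the prolongation of `V` for the variable `u_x^{(α)}`. -/
def etaFracX (α : ℝ) (V : Pt → Pt) (u : ℝ × ℝ → ℝ) (p : ℝ × ℝ) : ℝ :=
  p.2 ^ (1 - α) * etaX V u p + (1 - α) * xi V u p * p.2 ^ (-α) * px u p

/-- The coefficient of the prolongation of `V` for the variable `u_x^{(3α)}`. -/
def etaFracXXX (α : ℝ) (V : Pt → Pt) (u : ℝ × ℝ → ℝ) (p : ℝ × ℝ) : ℝ :=
  p.2 ^ (3 - 3 * α) * etaXXX V u p
    + (3 - 3 * α) * p.2 ^ (2 - 3 * α) * etaXX V u p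
    + (1 - α) * (1 - 2 * α) * p.2 ^ (1 - 3 * α) * etaX V u p
    + (3 - 3 * α) * xi V u p * p.2 ^ (2 - 3 * α) * px (px (px u)) p
    + (3 - 3 * α) * (2 - 3 * α) * xi V u p * p.2 ^ (1 - 3 * α) * px (px u) p
    + (1 - α) * (1 - 2 * α) * (1 - 3 * α) * xi V u p * p.2 ^ (-(3 * α)) * px u p

/-- The prolongation of `V` applied to `u_t^{(β)} - 6 u² u_x^{(α)} + u_x^{(3α)}`. -/
def prolongedOp (α β : ℝ) (V : Pt → Pt) (u : ℝ × ℝ → ℝ) (p : ℝ × ℝ) : ℝ :=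
  -12 * eta V u p * u p * fracX α u p + etaFracT β V u p
    - 6 * etaFracX α V u p * u p ^ 2 + etaFracXXX α V u p

/-- The Lie symmetry condition `pr V (Δ) = 0` whenever `Δ = 0`, where `Δ` is the left-hand side of
the fractional mKdV equation. -/
def LieCondition (α β : ℝ) (V : Pt → Pt) : Prop :=
  ∀ u : ℝ × ℝ → ℝ, ContDiff ℝ ∞ u → ∀ p ∈ quadrant,
    mkdvOp α β u p = 0 → prolongedOp α β V u p = 0

/-! ### The three vector fields -/

/-- `V₁ = t^{1-β} ∂/∂t`, `V₂ = x^{1-α} ∂/∂x`, `V₃ = (3t/β) ∂/∂t + (x/α) ∂/∂x - u ∂/∂u`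
(indexed by `0, 1, 2`). -/
def basisField (α β : ℝ) : Fin 3 → Pt → Pt :=
  ![fun p => (p.1 ^ (1 - β), 0, 0),
    fun p => (0, p.2.1 ^ (1 - α), 0),
    fun p => (3 * p.1 / β, p.2.1 / α, -p.2.2)]

end FracMKdV

end

noncomputable section
namespace FracMKdV

open Set Filter Topology

/-! ### Weighted directional derivatives. -/

section WeightedDerivative

variable {E : Type*} [NormedAddCommGroup E] [NormedSpace ℝ E]

/-! In the variables `T = t ^ β / β`, `X = x ^ α / α` the conformable derivatives are ordinary ones
and the equation is the classical mKdV equation. The proof keeps `t` and `x`, and replaces the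
change of variables by the commuting derivations `t ^ (1 - β) ∂/∂t` and `x ^ (1 - α) ∂/∂x`, both
instances of `wd`. `IsCoeffOn.prolongedOp_eq` shows that, for the coefficients of `V` in this frame,
the fractional prolongation has the classical shape.

The necessary conditions are read off from travelling waves `u = f (X - c T)` with `f''' = (6 f² +
c) f'` alone. Such solutions need only the existence theorem for ODEs, and at a point one may
prescribe `u`, its first two `X`-derivatives and the speed `c` (`exists_isWaveOn`). That is already
enough freedom, so no existence theory for the PDE enters. Conditions (a) and (b) both imply the
same `WaveCondition`. For (b) one substitutes the wave into the prolongation. For (a) the flow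
deforms the graph of the wave into a family of solutions (`exists_deformation`); its `ε`-derivative
at `0` is the characteristic `η - u_x ξ - u_t τ`, which therefore solves the linearized equation
(`linearizedOp_eq_zero_of_family`), and along a wave the two expressions agree.

Written in jets, `WaveCondition` is a polynomial identity in three free parameters
(`WaveCondition.jet_eq`). Its coefficients are the determining equations, which
`WaveCondition.isClassified` solves. Conversely, a classified field has an explicit flow, affine in
`t ^ β` and `x ^ α` and linear in `u`, which multiplies the operator by `exp (4 c₁ ε)`; this gives
(a). Its infinitesimal counterpart, that the prolongation of the operator is `4 c₁` times the
operator, gives (b). -/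

/-- The directional derivative in the direction `v`, multiplied by the weight `w`. -/
def wd (w : E → ℝ) (v : E) (g : E → ℝ) (z : E) : ℝ := w z * fderiv ℝ g z v

variable {w w' : E → ℝ} {v v' : E} {f g : E → ℝ} {z : E} {N : Set E}

theorem wd_congr (hN : IsOpen N) (h : EqOn f g N) : EqOn (wd w v f) (wd w v g) N := by
  intro z hz
  simp only [wd, (h.eventuallyEq_of_mem (hN.mem_nhds hz)).fderiv_eq]

theorem wd_contDiffOn (hN : IsOpen N) (hw : ContDiffOn ℝ ∞ w N) (hf : ContDiffOn ℝ ∞ f N) :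
    ContDiffOn ℝ ∞ (wd w v f) N :=
  hw.mul ((hf.fderiv_of_isOpen hN (by simp)).clm_apply contDiffOn_const)

theorem wd_add (hf : DifferentiableAt ℝ f z) (hg : DifferentiableAt ℝ g z) :
    wd w v (fun y => f y + g y) z = wd w v f z + wd w v g z := by
  simp only [wd, fderiv_fun_add hf hg, _root_.add_apply]; ring

theorem wd_sub (hf : DifferentiableAt ℝ f z) (hg : DifferentiableAt ℝ g z) :
    wd w v (fun y => f y - g y) z = wd w v f z - wd w v g z := by
  simp only [wd, fderiv_fun_sub hf hg, _root_.sub_apply]; ring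

theorem wd_mul (hf : DifferentiableAt ℝ f z) (hg : DifferentiableAt ℝ g z) :
    wd w v (fun y => f y * g y) z = wd w v f z * g z + f z * wd w v g z := by
  simp only [wd, fderiv_fun_mul hf hg, _root_.add_apply,
    _root_.smul_apply, smul_eq_mul]; ring

theorem wd_const (c : ℝ) : wd w v (fun _ => c) z = 0 := by
  simp [wd]

theorem wd_const_mul (c : ℝ) (hf : DifferentiableAt ℝ f z) :
    wd w v (fun y => c * f y) z = c * wd w v f z := by
  rw [wd_mul (differentiableAt_const c) hf, wd_const]; ring

theorem _root_.ContDiffOn.differentiableAt_of_isOpen {F : Type*} [NormedAddCommGroup F]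
    [NormedSpace ℝ F] {f : E → F} (hf : ContDiffOn ℝ ∞ f N) (hN : IsOpen N) (hz : z ∈ N) :
    DifferentiableAt ℝ f z :=
  (hf.contDiffAt (hN.mem_nhds hz)).differentiableAt (by simp)

/-- Weighted directional derivatives commute if each weight is constant in the direction of
the other derivative. -/
theorem wd_comm (hN : IsOpen N) (hf : ContDiffOn ℝ ∞ f N) (hw : ContDiffOn ℝ ∞ w N)
    (hw' : ContDiffOn ℝ ∞ w' N) (h : ∀ y ∈ N, fderiv ℝ w y v' = 0)
    (h' : ∀ y ∈ N, fderiv ℝ w' y v = 0) (hz : z ∈ N) :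
    wd w v (wd w' v' f) z = wd w' v' (wd w v f) z := by
  have hd : DifferentiableAt ℝ (fderiv ℝ f) z :=
    (hf.fderiv_of_isOpen (m := ∞) hN (by simp)).differentiableAt_of_isOpen hN hz
  -- The product rule has a second term, the derivative of the weight in the direction `a`; it
  -- vanishes by assumption, and symmetry of the second derivative does the rest.
  have key : ∀ (w : E → ℝ) (v a : E), ContDiffOn ℝ ∞ w N → fderiv ℝ w z a = 0 →
      fderiv ℝ (wd w v f) z a = w z * fderiv ℝ (fderiv ℝ f) z a v := by
    intro w v a hw h
    have hwz := hw.differentiableAt_of_isOpen hN hz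
    have hfd : DifferentiableAt ℝ (fun y => fderiv ℝ f y v) z :=
      hd.clm_apply (differentiableAt_const v)
    unfold wd
    rw [fderiv_fun_mul hwz hfd, fderiv_clm_apply hd (differentiableAt_const v)]
    simp [h]
  have hsymm := (hf.contDiffAt (hN.mem_nhds hz)).isSymmSndFDerivAt
    (by
      rw [minSmoothness_of_isRCLikeNormedField]
      exact WithTop.coe_le_coe.2 (le_top : (2 : ℕ∞) ≤ ⊤))
  unfold wd at key ⊢
  rw [key w' v' v hw' (h' z hz), key w v v' hw (h z hz), hsymm.eq v v']
  ring

end WeightedDerivative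

/-! ### Weighted partial derivatives in the plane -/

theorem isOpen_quadrant : IsOpen quadrant :=
  (isOpen_lt continuous_const continuous_fst).inter (isOpen_lt continuous_const continuous_snd)

theorem isOpen_dom : IsOpen dom :=
  (isOpen_lt continuous_const continuous_fst).inter
    (isOpen_lt continuous_const (continuous_fst.comp continuous_snd))

/-- The derivation `t ^ (1 - β) ∂/∂t` of functions of `(t, x)`. -/
local notation:max "δt" β:max => wd (fun q : ℝ × ℝ => Prod.fst q ^ (1 - β)) ((1 : ℝ), (0 : ℝ))

/-- The derivation `x ^ (1 - α) ∂/∂x` of functions of `(t, x)`. -/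
local notation:max "δx" α:max => wd (fun q : ℝ × ℝ => Prod.snd q ^ (1 - α)) ((0 : ℝ), (1 : ℝ))

/-- The difference quotient is an ordinary one with a rescaled increment. The chain rule for a
linear rescaling needs no differentiability, so neither `f` nor `s` is restricted. -/
theorem conformableDeriv_eq {α s : ℝ} (f : ℝ → ℝ) :
    conformableDeriv α f s = s ^ (1 - α) * deriv f s := by
  unfold conformableDeriv
  have h := deriv_comp_mul_left (s ^ (1 - α)) (fun y => f (s + y)) 0
  simp only [mul_zero, smul_eq_mul] at h
  simp only [mul_comm _ (s ^ (1 - α))]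
  rw [h, deriv_comp_const_add, add_zero]

theorem fracX_eq (α : ℝ) (u : ℝ × ℝ → ℝ) (p : ℝ × ℝ) :
    fracX α u p = p.2 ^ (1 - α) * px u p := conformableDeriv_eq _

theorem fracT_eq (β : ℝ) (u : ℝ × ℝ → ℝ) (p : ℝ × ℝ) :
    fracT β u p = p.1 ^ (1 - β) * pt u p := conformableDeriv_eq _

variable {α β : ℝ} {f g u : ℝ × ℝ → ℝ} {p q : ℝ × ℝ} {N : Set (ℝ × ℝ)}

theorem px_eq_fderiv (hf : DifferentiableAt ℝ f p) : px f p = fderiv ℝ f p (0, 1) := by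
  have h1 : HasDerivAt (fun x : ℝ => (p.1, x)) ((0 : ℝ), (1 : ℝ)) p.2 :=
    (hasDerivAt_const _ _).prodMk (hasDerivAt_id _)
  exact (HasFDerivAt.comp_hasDerivAt (f := fun x : ℝ => (p.1, x)) p.2
    (l := f) (l' := fderiv ℝ f p) hf.hasFDerivAt h1).deriv

theorem pt_eq_fderiv (hf : DifferentiableAt ℝ f p) : pt f p = fderiv ℝ f p (1, 0) := by
  have h1 : HasDerivAt (fun t : ℝ => (t, p.2)) ((1 : ℝ), (0 : ℝ)) p.1 :=
    (hasDerivAt_id _).prodMk (hasDerivAt_const _ _)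
  exact (HasFDerivAt.comp_hasDerivAt (f := fun t : ℝ => (t, p.2)) p.1
    (l := f) (l' := fderiv ℝ f p) hf.hasFDerivAt h1).deriv

theorem fracX_eq_δx (hf : DifferentiableAt ℝ f p) : fracX α f p = δx α f p := by
  rw [fracX_eq, px_eq_fderiv hf]; rfl

theorem fracT_eq_δt (hf : DifferentiableAt ℝ f p) : fracT β f p = δt β f p := by
  rw [fracT_eq, pt_eq_fderiv hf]; rfl

theorem contDiffOn_rpow_fst (hN : N ⊆ quadrant) (r : ℝ) :
    ContDiffOn ℝ ∞ (fun q : ℝ × ℝ => q.1 ^ r) N :=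
  contDiff_fst.contDiffOn.rpow_const_of_ne fun _ hq => (hN hq).1.ne'

theorem contDiffOn_rpow_snd (hN : N ⊆ quadrant) (r : ℝ) :
    ContDiffOn ℝ ∞ (fun q : ℝ × ℝ => q.2 ^ r) N :=
  contDiff_snd.contDiffOn.rpow_const_of_ne fun _ hq => (hN hq).2.ne'

theorem contDiffOn_δx (hN : IsOpen N) (hNq : N ⊆ quadrant) (hf : ContDiffOn ℝ ∞ f N) :
    ContDiffOn ℝ ∞ (δx α f) N := wd_contDiffOn hN (contDiffOn_rpow_snd hNq _) hf

theorem contDiffOn_δt (hN : IsOpen N) (hNq : N ⊆ quadrant) (hf : ContDiffOn ℝ ∞ f N) :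
    ContDiffOn ℝ ∞ (δt β f) N := wd_contDiffOn hN (contDiffOn_rpow_fst hNq _) hf

theorem px_congr (hN : IsOpen N) (h : EqOn f g N) : EqOn (px f) (px g) N := by
  intro q hq
  refine Filter.EventuallyEq.deriv_eq ?_
  have hc : Continuous (fun x : ℝ => (q.1, x)) := by fun_prop
  filter_upwards [hc.continuousAt.preimage_mem_nhds (hN.mem_nhds (by exact hq))] with x hx
  exact h hx

theorem fracX_congr (hN : IsOpen N) (h : EqOn f g N) : EqOn (fracX α f) (fracX α g) N := by
  intro q hq
  rw [fracX_eq, fracX_eq, px_congr hN h hq]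

theorem fracX_eqOn (hN : IsOpen N) (hf : ContDiffOn ℝ ∞ f N) :
    EqOn (fracX α f) (δx α f) N :=
  fun _ hq => fracX_eq_δx (hf.differentiableAt_of_isOpen hN hq)

theorem mkdvOp_eqOn (hN : IsOpen N) (hNq : N ⊆ quadrant) (hu : ContDiffOn ℝ ∞ u N) :
    EqOn (mkdvOp α β u)
      (fun q => δt β u q - 6 * u q ^ 2 * δx α u q + δx α (δx α (δx α u)) q) N := by
  intro q hq
  have h1 : EqOn (fracX α u) (δx α u) N := fracX_eqOn hN hu
  have s1 : ContDiffOn ℝ ∞ (δx α u) N := contDiffOn_δx hN hNq hu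
  have h2 : EqOn (fracX α (fracX α u)) (δx α (δx α u)) N := fun q hq =>
    (fracX_congr hN h1 hq).trans (fracX_eqOn hN s1 hq)
  have h3 : EqOn (fracX α (fracX α (fracX α u))) (δx α (δx α (δx α u))) N := fun q hq =>
    (fracX_congr hN h2 hq).trans (fracX_eqOn hN (contDiffOn_δx hN hNq s1) hq)
  simp only [mkdvOp, h1 hq, h3 hq, fracT_eq_δt (hu.differentiableAt_of_isOpen hN hq)]

theorem fderiv_rpow_snd_apply (hq : q ∈ quadrant) (r : ℝ) (v : ℝ × ℝ) :
    fderiv ℝ (fun q : ℝ × ℝ => q.2 ^ r) q v = r * q.2 ^ (r - 1) * v.2 := by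
  have h := (Real.hasDerivAt_rpow_const (p := r) (Or.inl hq.2.ne')).comp_hasFDerivAt q
    (hasFDerivAt_snd (𝕜 := ℝ) (E := ℝ) (F := ℝ))
  rw [show (fun q : ℝ × ℝ => q.2 ^ r) = (fun x : ℝ => x ^ r) ∘ Prod.snd from rfl, h.fderiv]
  simp

theorem fderiv_rpow_fst_apply (hq : q ∈ quadrant) (r : ℝ) (v : ℝ × ℝ) :
    fderiv ℝ (fun q : ℝ × ℝ => q.1 ^ r) q v = r * q.1 ^ (r - 1) * v.1 := by
  have h := (Real.hasDerivAt_rpow_const (p := r) (Or.inl hq.1.ne')).comp_hasFDerivAt q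
    (hasFDerivAt_fst (𝕜 := ℝ) (E := ℝ) (F := ℝ))
  rw [show (fun q : ℝ × ℝ => q.1 ^ r) = (fun x : ℝ => x ^ r) ∘ Prod.fst from rfl, h.fderiv]
  simp

theorem δx_δt_comm (hN : IsOpen N) (hNq : N ⊆ quadrant) (hf : ContDiffOn ℝ ∞ f N) (hq : q ∈ N) :
    δx α (δt β f) q = δt β (δx α f) q :=
  wd_comm hN hf (contDiffOn_rpow_snd hNq _) (contDiffOn_rpow_fst hNq _)
    (fun y hy => by rw [fderiv_rpow_snd_apply (hNq hy)]; simp)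
    (fun y hy => by rw [fderiv_rpow_fst_apply (hNq hy)]; simp) hq

theorem δx_rpow_snd (hq : q ∈ quadrant) (r : ℝ) :
    δx α (fun q => q.2 ^ r) q = r * q.2 ^ (r - α) := by
  simp only [wd]
  rw [fderiv_rpow_snd_apply hq, show r - α = (1 - α) + (r - 1) by ring,
    Real.rpow_add hq.2]; ring

theorem δt_rpow_fst (hq : q ∈ quadrant) (r : ℝ) :
    δt β (fun q => q.1 ^ r) q = r * q.1 ^ (r - β) := by
  simp only [wd]
  rw [fderiv_rpow_fst_apply hq, show r - β = (1 - β) + (r - 1) by ring,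
    Real.rpow_add hq.1]; ring

theorem δx_rpow_fst (hq : q ∈ quadrant) (r : ℝ) : δx α (fun q => q.1 ^ r) q = 0 := by
  simp only [wd]
  rw [fderiv_rpow_fst_apply hq]; simp

theorem δt_rpow_snd (hq : q ∈ quadrant) (r : ℝ) : δt β (fun q => q.2 ^ r) q = 0 := by
  simp only [wd]
  rw [fderiv_rpow_snd_apply hq]; simp

/-! ### Travelling waves -/

/-- On `N` the function `u` is a travelling wave of speed `c` in the variables `t ^ β / β`,
`x ^ α / α`, whose profile satisfies `f''' = (6 f² + c) f'`. -/
structure IsWaveOn (α β c : ℝ) (u : ℝ × ℝ → ℝ) (N : Set (ℝ × ℝ)) : Prop where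
  isOpen : IsOpen N
  subset : N ⊆ quadrant
  smooth : ContDiffOn ℝ ∞ u N
  δt_eq : ∀ q ∈ N, δt β u q = -c * δx α u q
  δx_three : ∀ q ∈ N, δx α (δx α (δx α u)) q = (6 * u q ^ 2 + c) * δx α u q

theorem IsWaveOn.isSolutionOn {c : ℝ} (h : IsWaveOn α β c u N) : IsSolutionOn α β u N where
  isOpen := h.isOpen
  subset := h.subset
  smooth := h.smooth
  eqn p hp := by
    rw [mkdvOp_eqOn h.isOpen h.subset h.smooth hp]
    simp only [h.δt_eq p hp, h.δx_three p hp]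
    ring

theorem IsWaveOn.congr {c : ℝ} {N' : Set (ℝ × ℝ)} (h : IsWaveOn α β c u N) (hN' : IsOpen N')
    (hs : N' ⊆ N) (hg : EqOn g u N') : IsWaveOn α β c g N' where
  isOpen := hN'
  subset := hs.trans h.subset
  smooth := (h.smooth.mono hs).congr hg
  δt_eq q hq := by
    rw [wd_congr hN' hg hq, wd_congr hN' hg hq, h.δt_eq q (hs hq)]
  δx_three q hq := by
    rw [wd_congr hN' (wd_congr hN' (wd_congr hN' hg)) hq, wd_congr hN' hg hq, hg hq,
      h.δx_three q (hs hq)]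

/-! ### Existence of travelling waves with prescribed jets. -/

/-- Bootstrapping: if `y` is `C^n`, then so is `y' = F ∘ y`, and hence `y` is `C^(n+1)`. -/
theorem contDiffOn_of_hasDerivAt_of_contDiff {E : Type*} [NormedAddCommGroup E] [NormedSpace ℝ E]
    {F : E → E} {y : ℝ → E} {s : Set ℝ} (hs : IsOpen s) (hF : ContDiff ℝ ∞ F)
    (hy : ∀ a ∈ s, HasDerivAt y (F (y a)) a) : ContDiffOn ℝ ∞ y s := by
  have hd : DifferentiableOn ℝ y s := fun a ha => (hy a ha).differentiableAt.differentiableWithinAt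
  refine contDiffOn_infty.2 fun n => ?_
  induction n with
  | zero => exact contDiffOn_zero.2 hd.continuousOn
  | succ n ih =>
    rw [show ((n + 1 : ℕ) : WithTop ℕ∞) = (n : WithTop ℕ∞) + 1 by simp,
      contDiffOn_succ_iff_deriv_of_isOpen hs]
    refine ⟨hd, by simp, ?_⟩
    have h1 : ContDiffOn ℝ n (fun a => F (y a)) s :=
      (hF.of_le (by exact_mod_cast le_top)).comp_contDiffOn ih
    exact h1.congr fun a ha => (hy a ha).deriv

/-- Multiplication by a bump function. It is needed because `LieCondition` tests only globally
smooth functions, while waves exist only locally. -/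
theorem exists_contDiff_eventuallyEq {E : Type*} [NormedAddCommGroup E] [NormedSpace ℝ E]
    [FiniteDimensional ℝ E] {f : E → ℝ} {N : Set E} {p : E} (hN : IsOpen N) (hp : p ∈ N)
    (hf : ContDiffOn ℝ ∞ f N) : ∃ g : E → ℝ, ContDiff ℝ ∞ g ∧ g =ᶠ[𝓝 p] f := by
  obtain ⟨r, hr, hrN⟩ := Metric.nhds_basis_closedBall.mem_iff.1 (hN.mem_nhds hp)
  let φ : ContDiffBump p := ⟨r / 2, r, half_pos hr, half_lt_self hr⟩
  refine ⟨fun y => φ y * f y, contDiff_iff_contDiffAt.2 fun y => ?_, ?_⟩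
  · by_cases hy : y ∈ N
    · exact φ.contDiffAt.mul (hf.contDiffAt (hN.mem_nhds hy))
    · have hy' : y ∉ tsupport φ := fun h => hy (hrN (by rwa [φ.tsupport_eq] at h))
      refine (contDiffAt_const (c := (0 : ℝ))).congr_of_eventuallyEq ?_
      filter_upwards [notMem_tsupport_iff_eventuallyEq.1 hy'] with z hz
      simp [hz]
  · filter_upwards [φ.eventuallyEq_one] with z hz
    simp [hz]

/-- Picard–Lindelöf for the profile equation written as a first-order system in `(f, f', f'')`. -/
theorem exists_waveProfile (c k a b : ℝ) : ∃ f₀ f₁ f₂ : ℝ → ℝ, ∃ ε > (0 : ℝ),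
    f₀ 0 = k ∧ f₁ 0 = a ∧ f₂ 0 = b ∧ ContDiffOn ℝ ∞ f₀ (Ioo (-ε) ε) ∧
    ∀ s ∈ Ioo (-ε) ε, HasDerivAt f₀ (f₁ s) s ∧ HasDerivAt f₁ (f₂ s) s ∧
      HasDerivAt f₂ ((6 * f₀ s ^ 2 + c) * f₁ s) s := by
  let F : ℝ × ℝ × ℝ → ℝ × ℝ × ℝ := fun y => (y.2.1, y.2.2, (6 * y.1 ^ 2 + c) * y.2.1)
  have hF : ContDiff ℝ ∞ F := by fun_prop
  obtain ⟨y, hy0, ε, hε, hy⟩ :=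
    (hF.contDiffAt.of_le (by exact_mod_cast le_top) :
      ContDiffAt ℝ 1 F (k, a, b)).exists_forall_mem_closedBall_exists_eq_forall_mem_Ioo_hasDerivAt₀ 0
  rw [zero_sub, zero_add] at hy
  refine ⟨fun s => (y s).1, fun s => (y s).2.1, fun s => (y s).2.2, ε, hε, by simp [hy0],
    by simp [hy0], by simp [hy0],
    contDiff_fst.comp_contDiffOn (contDiffOn_of_hasDerivAt_of_contDiff isOpen_Ioo hF hy),
    fun s hs => ⟨(hy s hs).fst, (hy s hs).snd.fst, (hy s hs).snd.snd⟩⟩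

theorem wd_comp {E : Type*} [NormedAddCommGroup E] [NormedSpace ℝ E] {w : E → ℝ} {v z : E}
    {h : ℝ → ℝ} {h' : ℝ} {θ : E → ℝ} (hh : HasDerivAt h h' (θ z)) (hθ : DifferentiableAt ℝ θ z) :
    wd w v (fun y => h (θ y)) z = h' * wd w v θ z := by
  have := hh.comp_hasFDerivAt z hθ.hasFDerivAt
  simp only [wd, show (fun y => h (θ y)) = h ∘ θ from rfl, this.fderiv]
  simp
  ring

/-- The travelling coordinate `x ^ α / α - c t ^ β / β`. -/
def phase (α β c : ℝ) (q : ℝ × ℝ) : ℝ := α⁻¹ * q.2 ^ α - c * β⁻¹ * q.1 ^ β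

theorem contDiffOn_phase (c : ℝ) : ContDiffOn ℝ ∞ (phase α β c) quadrant :=
  (contDiffOn_const.mul (contDiffOn_rpow_snd Subset.rfl _)).sub
    (contDiffOn_const.mul (contDiffOn_rpow_fst Subset.rfl _))

theorem differentiableAt_rpow_fst (hq : q ∈ quadrant) (r : ℝ) :
    DifferentiableAt ℝ (fun q : ℝ × ℝ => q.1 ^ r) q :=
  (contDiffOn_rpow_fst Subset.rfl r).differentiableAt_of_isOpen isOpen_quadrant hq

theorem differentiableAt_rpow_snd (hq : q ∈ quadrant) (r : ℝ) :
    DifferentiableAt ℝ (fun q : ℝ × ℝ => q.2 ^ r) q :=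
  (contDiffOn_rpow_snd Subset.rfl r).differentiableAt_of_isOpen isOpen_quadrant hq

theorem δx_phase (hα : α ≠ 0) (c : ℝ) (hq : q ∈ quadrant) : δx α (phase α β c) q = 1 := by
  have h1 := differentiableAt_rpow_snd hq α
  have h2 := differentiableAt_rpow_fst hq β
  change δx _ (fun q => α⁻¹ * q.2 ^ α - c * β⁻¹ * q.1 ^ β) q = _
  rw [wd_sub (h1.const_mul _) (h2.const_mul _), wd_const_mul _ h1, wd_const_mul _ h2,
    δx_rpow_snd hq, δx_rpow_fst hq]
  simp [hα]

theorem δt_phase (hβ : β ≠ 0) (c : ℝ) (hq : q ∈ quadrant) : δt β (phase α β c) q = -c := by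
  have h1 := differentiableAt_rpow_snd hq α
  have h2 := differentiableAt_rpow_fst hq β
  change δt _ (fun q => α⁻¹ * q.2 ^ α - c * β⁻¹ * q.1 ^ β) q = _
  rw [wd_sub (h1.const_mul _) (h2.const_mul _), wd_const_mul _ h1, wd_const_mul _ h2,
    δt_rpow_snd hq, δt_rpow_fst hq]
  simp [hβ]

/-- The wave is the profile composed with the phase, shifted to vanish at `p`. The phase has
weighted derivatives `1` and `-c`, so the initial data of the profile become the jet of the wave at
`p`. -/
theorem exists_isWaveOn (hα : α ≠ 0) (hβ : β ≠ 0) (hp : p ∈ quadrant) (c k a b : ℝ) :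
    ∃ u : ℝ × ℝ → ℝ, ∃ N, ContDiff ℝ ∞ u ∧ IsWaveOn α β c u N ∧ p ∈ N ∧ u p = k ∧
      δx α u p = a ∧ δx α (δx α u) p = b := by
  obtain ⟨f₀, f₁, f₂, ε, hε, h0, h1, h2, hsm, hf⟩ := exists_waveProfile c k a b
  let θ : ℝ × ℝ → ℝ := fun q => phase α β c q - phase α β c p
  have hθs : ContDiffOn ℝ ∞ θ quadrant := (contDiffOn_phase c).sub contDiffOn_const
  have hθp : θ p = 0 := sub_self _
  let N := quadrant ∩ θ ⁻¹' Ioo (-ε) ε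
  have hN : IsOpen N := hθs.continuousOn.isOpen_inter_preimage isOpen_quadrant isOpen_Ioo
  have hpN : p ∈ N := ⟨hp, by simp [hθp, hε]⟩
  have hNq : N ⊆ quadrant := inter_subset_left
  have hph : ∀ q ∈ N, DifferentiableAt ℝ (phase α β c) q := fun q hq =>
    (contDiffOn_phase c).differentiableAt_of_isOpen isOpen_quadrant hq.1
  have hθd : ∀ q ∈ N, DifferentiableAt ℝ θ q := fun q hq =>
    hθs.differentiableAt_of_isOpen isOpen_quadrant hq.1
  have hθx : ∀ q ∈ N, δx α θ q = 1 := fun q hq => by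
    rw [wd_sub (hph q hq) (differentiableAt_const _), wd_const, δx_phase hα c hq.1, sub_zero]
  have hθt : ∀ q ∈ N, δt β θ q = -c := fun q hq => by
    rw [wd_sub (hph q hq) (differentiableAt_const _), wd_const, δt_phase hβ c hq.1, sub_zero]
  have e1 : EqOn (δx α fun q => f₀ (θ q)) (fun q => f₁ (θ q)) N := fun q hq => by
    rw [wd_comp (hf _ hq.2).1 (hθd q hq), hθx q hq, mul_one]
  have e2 : EqOn (δx α fun q => f₁ (θ q)) (fun q => f₂ (θ q)) N := fun q hq => by
    rw [wd_comp (hf _ hq.2).2.1 (hθd q hq), hθx q hq, mul_one]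
  have e12 : EqOn (δx α (δx α fun q => f₀ (θ q))) (fun q => f₂ (θ q)) N :=
    (wd_congr hN e1).trans e2
  have hw : IsWaveOn α β c (fun q => f₀ (θ q)) N :=
    { isOpen := hN
      subset := hNq
      smooth := hsm.comp (hθs.mono hNq) fun q hq => hq.2
      δt_eq := fun q hq => by
        rw [wd_comp (hf _ hq.2).1 (hθd q hq), hθt q hq, e1 hq, mul_comm]
      δx_three := fun q hq => by
        rw [wd_congr hN e12 hq, wd_comp (hf _ hq.2).2.2 (hθd q hq), hθx q hq, mul_one, e1 hq] }
  obtain ⟨u, hu, hup⟩ := exists_contDiff_eventuallyEq hN hpN hw.smooth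
  obtain ⟨N', hN's, hN', hpN'⟩ := mem_nhds_iff.1 (inter_mem hup (hN.mem_nhds hpN))
  have hE : EqOn u (fun q => f₀ (θ q)) N' := fun q hq => (hN's hq).1
  refine ⟨u, N', hu, hw.congr hN' (fun q hq => (hN's hq).2) hE, hpN', ?_, ?_, ?_⟩
  · exact (hE hpN').trans (by simp only [hθp, h0])
  · rw [wd_congr hN' hE hpN', e1 hpN]
    simp only [hθp, h1]
  · rw [wd_congr hN' (wd_congr hN' hE) hpN', e12 hpN]
    simp only [hθp, h2]

/-! ### The prolongation in terms of the weighted derivatives -/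

/-- `f` is differentiable at `z` and its weighted directional derivative there is `f'`. -/
def HasWd {E : Type*} [NormedAddCommGroup E] [NormedSpace ℝ E] (w : E → ℝ) (v : E) (f : E → ℝ)
    (f' : ℝ) (z : E) : Prop := DifferentiableAt ℝ f z ∧ wd w v f z = f'

section HasWd

variable {E : Type*} [NormedAddCommGroup E] [NormedSpace ℝ E] {w : E → ℝ} {v z : E}
  {f g : E → ℝ} {f' g' : ℝ} {N : Set E}

theorem HasWd.add (hf : HasWd w v f f' z) (hg : HasWd w v g g' z) :
    HasWd w v (fun y => f y + g y) (f' + g') z :=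
  ⟨hf.1.add hg.1, by rw [wd_add hf.1 hg.1, hf.2, hg.2]⟩

theorem HasWd.sub (hf : HasWd w v f f' z) (hg : HasWd w v g g' z) :
    HasWd w v (fun y => f y - g y) (f' - g') z :=
  ⟨hf.1.sub hg.1, by rw [wd_sub hf.1 hg.1, hf.2, hg.2]⟩

theorem HasWd.mul (hf : HasWd w v f f' z) (hg : HasWd w v g g' z) :
    HasWd w v (fun y => f y * g y) (f' * g z + f z * g') z :=
  ⟨hf.1.mul hg.1, by rw [wd_mul hf.1 hg.1, hf.2, hg.2]⟩

theorem HasWd.const_mul (c : ℝ) (hf : HasWd w v f f' z) :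
    HasWd w v (fun y => c * f y) (c * f') z :=
  ⟨hf.1.const_mul c, by rw [wd_const_mul c hf.1, hf.2]⟩

theorem HasWd.congr (hN : IsOpen N) (hz : z ∈ N) (h : EqOn g f N) (hf : HasWd w v f f' z) :
    HasWd w v g f' z :=
  ⟨hf.1.congr_of_eventuallyEq (h.eventuallyEq_of_mem (hN.mem_nhds hz)), by
    rw [wd_congr hN h hz, hf.2]⟩

theorem _root_.ContDiffOn.hasWd (hf : ContDiffOn ℝ ∞ f N) (hN : IsOpen N) (hz : z ∈ N) :
    HasWd w v f (wd w v f z) z := ⟨hf.differentiableAt_of_isOpen hN hz, rfl⟩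

end HasWd

/-- Returns from the weighted to the ordinary derivative; the prolongation is defined by ordinary
ones but computed by weighted ones. -/
theorem HasWd.px {f' : ℝ} (hq : q ∈ quadrant)
    (h : HasWd (fun q : ℝ × ℝ => q.2 ^ (1 - α)) (0, 1) f f' q) :
    px f q = q.2 ^ (α - 1) * f' := by
  rw [← h.2, ← fracX_eq_δx h.1, fracX_eq, ← mul_assoc, ← Real.rpow_add hq.2]
  simp

theorem HasWd.pt {f' : ℝ} (hq : q ∈ quadrant)
    (h : HasWd (fun q : ℝ × ℝ => q.1 ^ (1 - β)) (1, 0) f f' q) :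
    pt f q = q.1 ^ (β - 1) * f' := by
  rw [← h.2, ← fracT_eq_δt h.1, fracT_eq, ← mul_assoc, ← Real.rpow_add hq.1]
  simp

theorem pt_congr (hN : IsOpen N) (h : EqOn f g N) : EqOn (pt f) (pt g) N := by
  intro q hq
  refine Filter.EventuallyEq.deriv_eq ?_
  have hc : Continuous (fun t : ℝ => (t, q.2)) := by fun_prop
  filter_upwards [hc.continuousAt.preimage_mem_nhds (hN.mem_nhds (by exact hq))] with t ht
  exact h ht

/-- This and the next lemma keep every derivative polynomial in `x ^ (α - 1)` and `x ^ (-α)`, so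
that `ring` can finish the prolongation formulas without rules for real powers. -/
theorem hasWd_rpow_snd_sub_one (hq : q ∈ quadrant) :
    HasWd (fun q : ℝ × ℝ => q.2 ^ (1 - α)) (0, 1) (fun q => q.2 ^ (α - 1))
      (-(1 - α) * q.2 ^ (-α) * q.2 ^ (α - 1)) q :=
  ⟨differentiableAt_rpow_snd hq _, by
    rw [δx_rpow_snd hq, mul_assoc, ← Real.rpow_add hq.2]
    ring_nf⟩

theorem hasWd_rpow_snd_neg (hq : q ∈ quadrant) :
    HasWd (fun q : ℝ × ℝ => q.2 ^ (1 - α)) (0, 1) (fun q => q.2 ^ (-α))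
      (-α * (q.2 ^ (-α)) ^ 2) q :=
  ⟨differentiableAt_rpow_snd hq _, by
    rw [δx_rpow_snd hq, pow_two, ← Real.rpow_add hq.2]
    ring_nf⟩

theorem hasWd_rpow_snd_one_sub (hq : q ∈ quadrant) :
    HasWd (fun q : ℝ × ℝ => q.2 ^ (1 - α)) (0, 1) (fun q => q.2 ^ (1 - α))
      ((1 - α) * q.2 ^ (-α) * q.2 ^ (1 - α)) q :=
  ⟨differentiableAt_rpow_snd hq _, by
    rw [δx_rpow_snd hq, mul_assoc, ← Real.rpow_add hq.2]
    ring_nf⟩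

theorem hasWd_x_rpow_fst (hq : q ∈ quadrant) (r : ℝ) :
    HasWd (fun q : ℝ × ℝ => q.2 ^ (1 - α)) (0, 1) (fun q => q.1 ^ r) 0 q :=
  ⟨differentiableAt_rpow_fst hq _, δx_rpow_fst hq r⟩

theorem hasWd_t_rpow_snd (hq : q ∈ quadrant) (r : ℝ) :
    HasWd (fun q : ℝ × ℝ => q.1 ^ (1 - β)) (1, 0) (fun q => q.2 ^ r) 0 q :=
  ⟨differentiableAt_rpow_snd hq _, δt_rpow_snd hq r⟩

theorem hasWd_rpow_fst_one_sub (hq : q ∈ quadrant) :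
    HasWd (fun q : ℝ × ℝ => q.1 ^ (1 - β)) (1, 0) (fun q => q.1 ^ (1 - β))
      ((1 - β) * q.1 ^ (-β) * q.1 ^ (1 - β)) q :=
  ⟨differentiableAt_rpow_fst hq _, by
    rw [δt_rpow_fst hq, mul_assoc, ← Real.rpow_add hq.1]
    ring_nf⟩

theorem rpow_sub_one_mul {s : ℝ} (hs : 0 < s) (r : ℝ) : s ^ (r - 1) * s ^ (1 - r) = 1 := by
  rw [← Real.rpow_add hs]; simp

/-- The functions `E`, `X`, `T` are the coefficients `η`, `x ^ (α - 1) ξ`, `t ^ (β - 1) τ` of the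
vector field `V` along the smooth function `u`. -/
structure IsCoeffOn (α β : ℝ) (V : Pt → Pt) (u E X T : ℝ × ℝ → ℝ) (N : Set (ℝ × ℝ)) : Prop where
  isOpen : IsOpen N
  subset : N ⊆ quadrant
  smooth : ContDiffOn ℝ ∞ u N
  smooth_eta : ContDiffOn ℝ ∞ E N
  smooth_xi : ContDiffOn ℝ ∞ X N
  smooth_tau : ContDiffOn ℝ ∞ T N
  eta_eq : EqOn (eta V u) E N
  xi_eq : EqOn (xi V u) (fun q => q.2 ^ (1 - α) * X q) N
  tau_eq : EqOn (tau V u) (fun q => q.1 ^ (1 - β) * T q) N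

namespace IsCoeffOn

variable {V : Pt → Pt} {E X T : ℝ × ℝ → ℝ} (h : IsCoeffOn α β V u E X T N)
include h

theorem px_eta (hq : q ∈ N) : px (eta V u) q = q.2 ^ (α - 1) * δx α E q :=
  (px_congr h.isOpen h.eta_eq hq).trans ((h.smooth_eta.hasWd h.isOpen hq).px (h.subset hq))

theorem px_xi (hq : q ∈ N) : px (xi V u) q = (1 - α) * q.2 ^ (-α) * X q + δx α X q := by
  rw [px_congr h.isOpen h.xi_eq hq, ((hasWd_rpow_snd_one_sub (h.subset hq)).mul
    (h.smooth_xi.hasWd h.isOpen hq)).px (h.subset hq)]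
  linear_combination ((1 - α) * q.2 ^ (-α) * X q + δx α X q) *
    rpow_sub_one_mul (h.subset hq).2 α

theorem px_tau (hq : q ∈ N) :
    px (tau V u) q = q.2 ^ (α - 1) * q.1 ^ (1 - β) * δx α T q := by
  rw [px_congr h.isOpen h.tau_eq hq, ((hasWd_x_rpow_fst (h.subset hq) _).mul
    (h.smooth_tau.hasWd h.isOpen hq)).px (h.subset hq)]
  ring

theorem pt_eta (hq : q ∈ N) : pt (eta V u) q = q.1 ^ (β - 1) * δt β E q :=
  (pt_congr h.isOpen h.eta_eq hq).trans ((h.smooth_eta.hasWd h.isOpen hq).pt (h.subset hq))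

theorem pt_xi (hq : q ∈ N) :
    pt (xi V u) q = q.1 ^ (β - 1) * q.2 ^ (1 - α) * δt β X q := by
  rw [pt_congr h.isOpen h.xi_eq hq, ((hasWd_t_rpow_snd (h.subset hq) _).mul
    (h.smooth_xi.hasWd h.isOpen hq)).pt (h.subset hq)]
  ring

theorem pt_tau (hq : q ∈ N) : pt (tau V u) q = (1 - β) * q.1 ^ (-β) * T q + δt β T q := by
  rw [pt_congr h.isOpen h.tau_eq hq, ((hasWd_rpow_fst_one_sub (h.subset hq)).mul
    (h.smooth_tau.hasWd h.isOpen hq)).pt (h.subset hq)]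
  linear_combination ((1 - β) * q.1 ^ (-β) * T q + δt β T q) *
    rpow_sub_one_mul (h.subset hq).1 β

theorem smooth_δx : ContDiffOn ℝ ∞ (δx α u) N := contDiffOn_δx h.isOpen h.subset h.smooth

theorem smooth_δt : ContDiffOn ℝ ∞ (δt β u) N := contDiffOn_δt h.isOpen h.subset h.smooth

theorem px_u (hq : q ∈ N) : px u q = q.2 ^ (α - 1) * δx α u q :=
  (h.smooth.hasWd h.isOpen hq).px (h.subset hq)

theorem pt_u (hq : q ∈ N) : pt u q = q.1 ^ (β - 1) * δt β u q :=
  (h.smooth.hasWd h.isOpen hq).pt (h.subset hq)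

theorem px_px_u (hq : q ∈ N) : px (px u) q =
    q.2 ^ (α - 1) * (q.2 ^ (α - 1) *
      (δx α (δx α u) q - (1 - α) * q.2 ^ (-α) * δx α u q)) := by
  rw [px_congr h.isOpen (fun q hq => h.px_u hq) hq,
    ((hasWd_rpow_snd_sub_one (h.subset hq)).mul (h.smooth_δx.hasWd h.isOpen hq)).px
      (h.subset hq)]
  ring

theorem px_px_px_u (hq : q ∈ N) : px (px (px u)) q = (q.2 ^ (α - 1)) ^ 3 *
    (δx α (δx α (δx α u)) q - 3 * (1 - α) * q.2 ^ (-α) * δx α (δx α u) q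
      + (1 - α) * (2 - α) * (q.2 ^ (-α)) ^ 2 * δx α u q) := by
  have hq' := h.subset hq
  have hm := hasWd_rpow_snd_sub_one (α := α) hq'
  have hr := hasWd_rpow_snd_neg (α := α) hq'
  have h1 := h.smooth_δx.hasWd (w := fun q : ℝ × ℝ => q.2 ^ (1 - α)) (v := (0, 1)) h.isOpen hq
  have h2 := (contDiffOn_δx (α := α) h.isOpen h.subset h.smooth_δx).hasWd
    (w := fun q : ℝ × ℝ => q.2 ^ (1 - α)) (v := (0, 1)) h.isOpen hq
  rw [px_congr h.isOpen (fun q hq => h.px_px_u hq) hq,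
    (hm.mul (hm.mul (h2.sub ((hr.const_mul _).mul h1)))).px hq']
  ring

theorem px_pt_u (hq : q ∈ N) :
    px (pt u) q = q.2 ^ (α - 1) * (q.1 ^ (β - 1) * δx α (δt β u) q) := by
  rw [px_congr h.isOpen (fun q hq => h.pt_u hq) hq,
    ((hasWd_x_rpow_fst (h.subset hq) _).mul (h.smooth_δt.hasWd h.isOpen hq)).px (h.subset hq)]
  ring

theorem px_px_pt_u (hq : q ∈ N) : px (px (pt u)) q = (q.2 ^ (α - 1)) ^ 2 * q.1 ^ (β - 1) *
    (δx α (δx α (δt β u)) q - (1 - α) * q.2 ^ (-α) * δx α (δt β u) q) := by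
  rw [px_congr h.isOpen (fun q hq => h.px_pt_u hq) hq,
    ((hasWd_rpow_snd_sub_one (h.subset hq)).mul ((hasWd_x_rpow_fst (h.subset hq) _).mul
      ((contDiffOn_δx h.isOpen h.subset h.smooth_δt).hasWd h.isOpen hq))).px (h.subset hq)]
  ring

/-- The coefficient of the prolongation for the first derivative `δx u`. -/
theorem etaX_eq (hq : q ∈ N) : etaX V u q = q.2 ^ (α - 1) *
    (δx α E q - δx α u q * δx α X q - δt β u q * δx α T q
      - (1 - α) * q.2 ^ (-α) * (δx α u q * X q)) := by
  rw [etaX, h.px_eta hq, h.px_u hq, h.px_xi hq, h.pt_u hq, h.px_tau hq]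
  linear_combination -(q.2 ^ (α - 1) * δt β u q * δx α T q) *
    rpow_sub_one_mul (h.subset hq).1 β

/-- The nested factors and the unexpanded products on the right-hand side are the shape in which
`etaXXX_eq` differentiates it term by term with `HasWd`. -/
theorem etaXX_eq (hq : q ∈ N) : etaXX V u q = q.2 ^ (α - 1) * (q.2 ^ (α - 1) *
    (δx α (δx α E) q - 2 * (δx α (δx α u) q * δx α X q) - δx α u q * δx α (δx α X) q
      - 2 * (δx α (δt β u) q * δx α T q) - δt β u q * δx α (δx α T) q
      - (1 - α) * q.2 ^ (-α) * (δx α E q - δx α u q * δx α X q - δt β u q * δx α T q)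
      + (1 - α) * (2 - α) * (q.2 ^ (-α) * q.2 ^ (-α)) * (δx α u q * X q)
      - 2 * (1 - α) * q.2 ^ (-α) * (δx α (δx α u) q * X q))) := by
  have hq' := h.subset hq
  have hm := hasWd_rpow_snd_sub_one (α := α) hq'
  have hr := hasWd_rpow_snd_neg (α := α) hq'
  have hd : ∀ {f : ℝ × ℝ → ℝ}, ContDiffOn ℝ ∞ f N → HasWd (fun q : ℝ × ℝ => q.2 ^ (1 - α)) (0, 1)
    f (δx α f q) q := fun hf => hf.hasWd h.isOpen hq
  have hs : ∀ {f : ℝ × ℝ → ℝ}, ContDiffOn ℝ ∞ f N → ContDiffOn ℝ ∞ (δx α f) N :=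
    contDiffOn_δx h.isOpen h.subset
  rw [etaXX, px_congr h.isOpen (fun q hq => h.etaX_eq hq) hq,
    (hm.mul ((((hd (hs h.smooth_eta)).sub ((hd h.smooth_δx).mul (hd (hs h.smooth_xi)))).sub
      ((hd h.smooth_δt).mul (hd (hs h.smooth_tau)))).sub
      ((hr.const_mul _).mul ((hd h.smooth_δx).mul (hd h.smooth_xi))))).px hq',
    h.px_px_u hq, h.px_xi hq, h.px_pt_u hq, h.px_tau hq]
  linear_combination -((q.2 ^ (α - 1)) ^ 2 * δx α (δt β u) q * δx α T q) *
    rpow_sub_one_mul (h.subset hq).1 β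

theorem etaXXX_eq (hq : q ∈ N) : etaXXX V u q = (q.2 ^ (α - 1)) ^ 3 *
    (δx α (δx α (δx α E)) q - 3 * δx α (δx α (δx α u)) q * δx α X q
      - 3 * δx α (δx α u) q * δx α (δx α X) q - δx α u q * δx α (δx α (δx α X)) q
      - 3 * δx α (δx α (δt β u)) q * δx α T q - 3 * δx α (δt β u) q * δx α (δx α T) q
      - δt β u q * δx α (δx α (δx α T)) q
      - 3 * (1 - α) * q.2 ^ (-α) *
        (δx α (δx α E) q - 2 * δx α (δx α u) q * δx α X q - δx α u q * δx α (δx α X) q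
        - 2 * δx α (δt β u) q * δx α T q - δt β u q * δx α (δx α T) q)
      + (1 - α) * (2 - α) * (q.2 ^ (-α)) ^ 2 *
        (δx α E q - δx α u q * δx α X q - δt β u q * δx α T q)
      + X q * (-3 * (1 - α) * q.2 ^ (-α) * δx α (δx α (δx α u)) q
        + 3 * (1 - α) * (3 - 2 * α) * (q.2 ^ (-α)) ^ 2 * δx α (δx α u) q
        - (1 - α) * (2 - α) * (3 - α) * (q.2 ^ (-α)) ^ 3 * δx α u q)) := by
  have hq' := h.subset hq
  have hm := hasWd_rpow_snd_sub_one (α := α) hq'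
  have hr := hasWd_rpow_snd_neg (α := α) hq'
  have hd : ∀ {f : ℝ × ℝ → ℝ}, ContDiffOn ℝ ∞ f N → HasWd (fun q : ℝ × ℝ => q.2 ^ (1 - α)) (0, 1)
    f (δx α f q) q := fun hf => hf.hasWd h.isOpen hq
  have hs : ∀ {f : ℝ × ℝ → ℝ}, ContDiffOn ℝ ∞ f N → ContDiffOn ℝ ∞ (δx α f) N :=
    contDiffOn_δx h.isOpen h.subset
  have hE := hs h.smooth_eta
  have hX := hs h.smooth_xi
  have hT := hs h.smooth_tau
  have hu := h.smooth_δx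
  have hv := h.smooth_δt
  have key := (hm.mul (hm.mul ((((((((hd (hs hE)).sub
    (((hd (hs hu)).mul (hd hX)).const_mul 2)).sub
    ((hd hu).mul (hd (hs hX)))).sub
    (((hd (hs hv)).mul (hd hT)).const_mul 2)).sub
    ((hd hv).mul (hd (hs hT)))).sub
    ((hr.const_mul (1 - α)).mul (((hd hE).sub ((hd hu).mul (hd hX))).sub
      ((hd hv).mul (hd hT))))).add
    (((hr.mul hr).const_mul ((1 - α) * (2 - α))).mul ((hd hu).mul (hd h.smooth_xi)))).sub
    ((hr.const_mul (2 * (1 - α))).mul ((hd (hs hu)).mul (hd h.smooth_xi)))))).px hq'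
  rw [etaXXX, px_congr h.isOpen (fun q hq => h.etaXX_eq hq) hq, key,
    h.px_px_px_u hq, h.px_xi hq, h.px_px_pt_u hq, h.px_tau hq]
  linear_combination -((q.2 ^ (α - 1)) ^ 3 *
    (δx α (δx α (δt β u)) q - (1 - α) * q.2 ^ (-α) * δx α (δt β u) q) * δx α T q) *
    rpow_sub_one_mul (h.subset hq).1 β

/-- The lower-order terms in the definitions of the fractional coefficients are exactly what cancels
the derivatives of the weights. What remains is the classical prolongation formula with the weighted
derivations in place of the partial derivatives. -/
theorem prolongedOp_eq (hq : q ∈ N) : prolongedOp α β V u q =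
    δt β E q - δx α u q * δt β X q - δt β u q * δt β T q
      - 12 * E q * u q * δx α u q
      - 6 * u q ^ 2 * (δx α E q - δx α u q * δx α X q - δt β u q * δx α T q)
      + δx α (δx α (δx α E)) q - 3 * δx α (δx α (δx α u)) q * δx α X q
      - 3 * δx α (δx α u) q * δx α (δx α X) q - δx α u q * δx α (δx α (δx α X)) q
      - 3 * δx α (δx α (δt β u)) q * δx α T q - 3 * δx α (δt β u) q * δx α (δx α T) q
      - δt β u q * δx α (δx α (δx α T)) q := by
  have hx := (h.subset hq).2
  have ht := (h.subset hq).1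
  -- All powers of `x` are reduced to `x ^ (1 - α)` and `x ^ (-α)`, after which the claim is a
  -- rational identity.
  have e3 : q.2 ^ (3 - 3 * α) = (q.2 ^ (1 - α)) ^ 3 := by
    rw [← Real.rpow_natCast, ← Real.rpow_mul hx.le]; norm_num; ring_nf
  have e2 : q.2 ^ (2 - 3 * α) = (q.2 ^ (1 - α)) ^ 2 * q.2 ^ (-α) := by
    rw [← Real.rpow_natCast, ← Real.rpow_mul hx.le, ← Real.rpow_add hx]; norm_num; ring_nf
  have e1 : q.2 ^ (1 - 3 * α) = q.2 ^ (1 - α) * (q.2 ^ (-α)) ^ 2 := by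
    rw [← Real.rpow_natCast, ← Real.rpow_mul hx.le, ← Real.rpow_add hx]; norm_num; ring_nf
  have e0 : q.2 ^ (-(3 * α)) = (q.2 ^ (-α)) ^ 3 := by
    rw [← Real.rpow_natCast, ← Real.rpow_mul hx.le]; norm_num; ring_nf
  have hm : q.2 ^ (α - 1) = (q.2 ^ (1 - α))⁻¹ := by rw [← Real.rpow_neg hx.le]; ring_nf
  have hn : q.1 ^ (β - 1) = (q.1 ^ (1 - β))⁻¹ := by rw [← Real.rpow_neg ht.le]; ring_nf
  have hw0 : q.2 ^ (1 - α) ≠ 0 := (Real.rpow_pos_of_pos hx _).ne'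
  have hv0 : q.1 ^ (1 - β) ≠ 0 := (Real.rpow_pos_of_pos ht _).ne'
  rw [prolongedOp, fracX_eq_δx (h.smooth.differentiableAt_of_isOpen h.isOpen hq), etaFracT,
    etaFracX, etaFracXXX, etaT, h.etaX_eq hq, h.etaXX_eq hq, h.etaXXX_eq hq, h.eta_eq hq,
    h.xi_eq hq, h.tau_eq hq, h.px_px_px_u hq, h.px_px_u hq, h.px_u hq, h.pt_u hq, h.pt_eta hq,
    h.pt_xi hq, h.pt_tau hq, e3, e2, e1, e0, hm, hn]
  field_simp
  ring

end IsCoeffOn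

/-! ### Coefficients of a vector field along a function -/

/-- The derivation `t ^ (1 - β) ∂/∂t` of functions of `(t, x, u)`. -/
local notation:max "dT" β:max =>
  wd (fun p : ℝ × ℝ × ℝ => Prod.fst p ^ (1 - β)) ((1 : ℝ), (0 : ℝ), (0 : ℝ))

/-- The derivation `x ^ (1 - α) ∂/∂x` of functions of `(t, x, u)`. -/
local notation:max "dX" α:max =>
  wd (fun p : ℝ × ℝ × ℝ => Prod.fst (Prod.snd p) ^ (1 - α)) ((0 : ℝ), (1 : ℝ), (0 : ℝ))

/-- The derivation `∂/∂u` of functions of `(t, x, u)`. -/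
local notation:max "dU" => wd (fun _ : ℝ × ℝ × ℝ => (1 : ℝ)) ((0 : ℝ), (0 : ℝ), (1 : ℝ))

/-- The coefficient `t ^ (β - 1) τ` of `V` with respect to `t ^ (1 - β) ∂/∂t`. -/
def tauC (β : ℝ) (V : Pt → Pt) (p : Pt) : ℝ := p.1 ^ (β - 1) * (V p).1

/-- The coefficient `x ^ (α - 1) ξ` of `V` with respect to `x ^ (1 - α) ∂/∂x`. -/
def xiC (α : ℝ) (V : Pt → Pt) (p : Pt) : ℝ := p.2.1 ^ (α - 1) * (V p).2.1

/-- The coefficient `η` of `V`. -/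
def etaC (V : Pt → Pt) (p : Pt) : ℝ := (V p).2.2

/-- The restriction of `g` to the graph of `u`, as a function of `(t, x)`. -/
def along (g : Pt → ℝ) (u : ℝ × ℝ → ℝ) (q : ℝ × ℝ) : ℝ := g (q.1, q.2, u q)

variable {V : Pt → Pt} {G H : Pt → ℝ}

theorem contDiffOn_dom_rpow_fst (r : ℝ) : ContDiffOn ℝ ∞ (fun p : Pt => p.1 ^ r) dom :=
  contDiff_fst.contDiffOn.rpow_const_of_ne fun _ hq => hq.1.ne'

theorem contDiffOn_dom_rpow_snd (r : ℝ) : ContDiffOn ℝ ∞ (fun p : Pt => p.2.1 ^ r) dom :=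
  (contDiff_fst.comp contDiff_snd).contDiffOn.rpow_const_of_ne fun _ hq => hq.2.ne'

theorem contDiffOn_tauC (hV : ContDiffOn ℝ ∞ V dom) : ContDiffOn ℝ ∞ (tauC β V) dom :=
  (contDiffOn_dom_rpow_fst _).mul (contDiff_fst.comp_contDiffOn hV)

theorem contDiffOn_xiC (hV : ContDiffOn ℝ ∞ V dom) : ContDiffOn ℝ ∞ (xiC α V) dom :=
  (contDiffOn_dom_rpow_snd _).mul ((contDiff_fst.comp contDiff_snd).comp_contDiffOn hV)

theorem contDiffOn_etaC (hV : ContDiffOn ℝ ∞ V dom) : ContDiffOn ℝ ∞ (etaC V) dom :=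
  (contDiff_snd.comp contDiff_snd).comp_contDiffOn hV

theorem contDiffOn_along (hN : N ⊆ quadrant) (hG : ContDiffOn ℝ ∞ G dom)
    (hu : ContDiffOn ℝ ∞ u N) : ContDiffOn ℝ ∞ (along G u) N :=
  hG.comp (contDiffOn_fst.prodMk (contDiffOn_snd.prodMk hu)) fun _ hq => hN hq

theorem isCoeffOn (hN : IsOpen N) (hNq : N ⊆ quadrant) (hu : ContDiffOn ℝ ∞ u N)
    (hV : ContDiffOn ℝ ∞ V dom) :
    IsCoeffOn α β V u (along (etaC V) u) (along (xiC α V) u) (along (tauC β V) u) N where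
  isOpen := hN
  subset := hNq
  smooth := hu
  smooth_eta := contDiffOn_along hNq (contDiffOn_etaC hV) hu
  smooth_xi := contDiffOn_along hNq (contDiffOn_xiC hV) hu
  smooth_tau := contDiffOn_along hNq (contDiffOn_tauC hV) hu
  eta_eq _ _ := rfl
  xi_eq q hq := by
    simp only [xi, along, xiC]
    linear_combination -(V (q.1, q.2, u q)).2.1 * rpow_sub_one_mul (hNq hq).2 α
  tau_eq q hq := by
    simp only [tau, along, tauC]
    linear_combination -(V (q.1, q.2, u q)).1 * rpow_sub_one_mul (hNq hq).1 β

/-! ### The linearized equation along a travelling wave -/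

/-- The linearization of the equation at `u`, applied to `Q`. -/
def linearizedOp (α β : ℝ) (u Q : ℝ × ℝ → ℝ) (q : ℝ × ℝ) : ℝ :=
  δt β Q q - 12 * u q * Q q * δx α u q - 6 * u q ^ 2 * δx α Q q + δx α (δx α (δx α Q)) q

/-- The characteristic `η - u_x ξ - u_t τ` of `V` along `u`. -/
def characteristic (α β : ℝ) (V : Pt → Pt) (u : ℝ × ℝ → ℝ) (q : ℝ × ℝ) : ℝ :=
  along (etaC V) u q - δx α u q * along (xiC α V) u q - δt β u q * along (tauC β V) u q

/-- The linearization of the equation at a travelling wave `u` of speed `c`, applied to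
`E - u_x (X - c T)`. -/
def waveOp (α β c : ℝ) (u E X T : ℝ × ℝ → ℝ) (q : ℝ × ℝ) : ℝ :=
  δt β E q - 12 * u q * δx α u q * E q - 6 * u q ^ 2 * δx α E q + δx α (δx α (δx α E)) q
    - δx α u q * (δt β X q - c * δt β T q)
    - (12 * u q ^ 2 + 3 * c) * δx α u q * (δx α X q - c * δx α T q)
    - 3 * δx α (δx α u) q * (δx α (δx α X) q - c * δx α (δx α T) q)
    - δx α u q * (δx α (δx α (δx α X)) q - c * δx α (δx α (δx α T)) q)

theorem δx_const_mul (hN : IsOpen N) (hf : ContDiffOn ℝ ∞ f N) (c : ℝ) :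
    EqOn (δx α fun q => c * f q) (fun q => c * δx α f q) N := fun _ hq =>
  wd_const_mul c (hf.differentiableAt_of_isOpen hN hq)

theorem IsWaveOn.δx_δt {c : ℝ} (h : IsWaveOn α β c u N) :
    EqOn (δx α (δt β u)) (fun q => -c * δx α (δx α u) q) N :=
  (wd_congr h.isOpen h.δt_eq).trans
    (δx_const_mul h.isOpen (contDiffOn_δx h.isOpen h.subset h.smooth) _)

theorem IsWaveOn.δx_δx_δt {c : ℝ} (h : IsWaveOn α β c u N) (hq : q ∈ N) :
    δx α (δx α (δt β u)) q = -c * ((6 * u q ^ 2 + c) * δx α u q) := by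
  rw [wd_congr h.isOpen h.δx_δt hq, δx_const_mul h.isOpen (contDiffOn_δx h.isOpen h.subset
    (contDiffOn_δx h.isOpen h.subset h.smooth)) _ hq]
  beta_reduce
  rw [h.δx_three q hq]

theorem IsWaveOn.prolongedOp_eq_waveOp {c : ℝ} (h : IsWaveOn α β c u N)
    (hV : ContDiffOn ℝ ∞ V dom) (hq : q ∈ N) : prolongedOp α β V u q =
      waveOp α β c u (along (etaC V) u) (along (xiC α V) u) (along (tauC β V) u) q := by
  rw [(isCoeffOn h.isOpen h.subset h.smooth hV).prolongedOp_eq hq, waveOp, h.δx_three q hq,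
    h.δx_δt hq, h.δx_δx_δt hq, h.δt_eq q hq]
  ring

/-- Along a wave `u_t = -c u_x`, so the characteristic is `E - u_x (X - c T)` and three applications
of the product rule suffice. The terms in the undifferentiated `X - c T` drop out, because `u_x`
itself solves the linearized equation. -/
theorem IsWaveOn.linearizedOp_characteristic {c : ℝ} (h : IsWaveOn α β c u N)
    (hV : ContDiffOn ℝ ∞ V dom) (hq : q ∈ N) : linearizedOp α β u (characteristic α β V u) q =
      waveOp α β c u (along (etaC V) u) (along (xiC α V) u) (along (tauC β V) u) q := by
  have hE := contDiffOn_along h.subset (contDiffOn_etaC hV) h.smooth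
  have hX := contDiffOn_along h.subset (contDiffOn_xiC (α := α) hV) h.smooth
  have hT := contDiffOn_along h.subset (contDiffOn_tauC (β := β) hV) h.smooth
  have hs : ∀ {f : ℝ × ℝ → ℝ}, ContDiffOn ℝ ∞ f N → ContDiffOn ℝ ∞ (δx α f) N :=
    contDiffOn_δx h.isOpen h.subset
  have hd : ∀ {f : ℝ × ℝ → ℝ} {q}, q ∈ N → ContDiffOn ℝ ∞ f N →
      HasWd (fun q : ℝ × ℝ => q.2 ^ (1 - α)) (0, 1) f (δx α f q) q :=
    fun hq hf => hf.hasWd h.isOpen hq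
  have hdt : ∀ {f : ℝ × ℝ → ℝ} {q}, q ∈ N → ContDiffOn ℝ ∞ f N →
      HasWd (fun q : ℝ × ℝ => q.1 ^ (1 - β)) (1, 0) f (δt β f q) q :=
    fun hq hf => hf.hasWd h.isOpen hq
  set E := along (etaC V) u
  set X := along (xiC α V) u
  set T := along (tauC β V) u
  have ha := hs h.smooth
  have hb := hs ha
  have e0 : EqOn (characteristic α β V u) (fun q => E q - δx α u q * (X q - c * T q)) N :=
    fun q hq => by simp only [characteristic, h.δt_eq q hq, E, X, T]; ring
  have e1 : EqOn (δx α (characteristic α β V u)) (fun q => δx α E q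
      - (δx α (δx α u) q * (X q - c * T q) + δx α u q * (δx α X q - c * δx α T q))) N :=
    fun q hq => (((hd hq hE).sub ((hd hq ha).mul ((hd hq hX).sub ((hd hq hT).const_mul c)))).congr
      h.isOpen hq e0).2
  -- The third derivative of `u` is eliminated by the profile equation before the last
  -- differentiation, so no fourth derivative appears.
  have e2 : EqOn (δx α (δx α (characteristic α β V u))) (fun q => δx α (δx α E) q
      - ((6 * u q ^ 2 + c) * δx α u q * (X q - c * T q)
        + δx α (δx α u) q * (δx α X q - c * δx α T q)
        + (δx α (δx α u) q * (δx α X q - c * δx α T q)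
        + δx α u q * (δx α (δx α X) q - c * δx α (δx α T) q)))) N := by
    intro q hq
    rw [(((hd hq (hs hE)).sub
      (((hd hq hb).mul ((hd hq hX).sub ((hd hq hT).const_mul c))).add
      ((hd hq ha).mul ((hd hq (hs hX)).sub ((hd hq (hs hT)).const_mul c))))).congr
      h.isOpen hq e1).2, h.δx_three q hq]
  have hu2 : HasWd (fun q : ℝ × ℝ => q.2 ^ (1 - α)) (0, 1) (fun q => 6 * u q ^ 2 + c)
      (12 * u q * δx α u q) q := by
    have h1 := (((hd hq h.smooth).mul (hd hq h.smooth)).const_mul 6).add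
      ⟨differentiableAt_const c, wd_const c⟩
    simp only [← pow_two] at h1
    convert h1 using 1
    ring
  have e3 := (((hd hq (hs (hs hE))).sub
      ((((hu2.mul (hd hq ha)).mul ((hd hq hX).sub ((hd hq hT).const_mul c))).add
      ((hd hq hb).mul ((hd hq (hs hX)).sub ((hd hq (hs hT)).const_mul c)))).add
      (((hd hq hb).mul ((hd hq (hs hX)).sub ((hd hq (hs hT)).const_mul c))).add
      ((hd hq ha).mul ((hd hq (hs (hs hX))).sub ((hd hq (hs (hs hT))).const_mul c)))))).congr
      h.isOpen hq e2).2
  have et := (((hdt hq hE).sub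
    ((hdt hq ha).mul ((hdt hq hX).sub ((hdt hq hT).const_mul c)))).congr h.isOpen hq e0).2
  have eat : δt β (δx α u) q = -c * δx α (δx α u) q := by
    rw [← δx_δt_comm h.isOpen h.subset h.smooth hq, h.δx_δt hq]
  rw [linearizedOp, et, e3, e1 hq, e0 hq, waveOp, eat, h.δx_three q hq]
  ring

/-- `V` satisfies the linearized symmetry condition along all travelling waves. -/
def WaveCondition (α β : ℝ) (V : Pt → Pt) : Prop :=
  ∀ (c : ℝ) (u : ℝ × ℝ → ℝ) (N : Set (ℝ × ℝ)), ContDiff ℝ ∞ u → IsWaveOn α β c u N →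
    ∀ q ∈ N, waveOp α β c u (along (etaC V) u) (along (xiC α V) u) (along (tauC β V) u) q = 0

theorem LieCondition.waveCondition (hV : ContDiffOn ℝ ∞ V dom) (h : LieCondition α β V) :
    WaveCondition α β V := fun _ u _ hu hw q hq => by
  rw [← hw.prolongedOp_eq_waveOp hV hq]
  exact h u hu q (hw.subset hq) (hw.isSolutionOn.eqn q hq)

/-! ### Classified fields satisfy the infinitesimal condition. -/

/-- The vector fields of the classification. -/
def IsClassified (α β : ℝ) (V : Pt → Pt) : Prop :=
  ∃ c₁ c₂ c₃ : ℝ, ∀ t x u : ℝ, 0 < t → 0 < x →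
    V (t, x, u) =
      (-3 * c₁ / β * t + c₂ * t ^ (1 - β), -c₁ / α * x + c₃ * x ^ (1 - α), c₁ * u)

/-- In the weighted frame the coefficients are `c₁ u`, `-c₁ X + c₃`, `-3 c₁ T + c₂` with constant
first derivatives. The prolongation then acts on the operator as multiplication by `4 c₁`. -/
theorem IsClassified.lieCondition (hα : α ≠ 0) (hβ : β ≠ 0) (h : IsClassified α β V) :
    LieCondition α β V := by
  obtain ⟨c₁, c₂, c₃, hV⟩ := h
  intro u hu p hp hsol
  have hO := isOpen_quadrant
  have hxs := contDiffOn_rpow_snd (N := quadrant) Subset.rfl α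
  have hts := contDiffOn_rpow_fst (N := quadrant) Subset.rfl β
  have hco : IsCoeffOn α β V u (fun q => c₁ * u q)
      (fun q => -c₁ / α * q.2 ^ α + c₃) (fun q => -3 * c₁ / β * q.1 ^ β + c₂) quadrant :=
    { isOpen := hO
      subset := Subset.rfl
      smooth := hu.contDiffOn
      smooth_eta := contDiffOn_const.mul hu.contDiffOn
      smooth_xi := (contDiffOn_const.mul hxs).add contDiffOn_const
      smooth_tau := (contDiffOn_const.mul hts).add contDiffOn_const
      eta_eq := fun q hq => by simp [eta, hV q.1 q.2 (u q) hq.1 hq.2]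
      xi_eq := fun q hq => by
        have := Real.rpow_add hq.2 (1 - α) α
        rw [sub_add_cancel, Real.rpow_one] at this
        simp only [xi, hV q.1 q.2 (u q) hq.1 hq.2]
        linear_combination -c₁ / α * this
      tau_eq := fun q hq => by
        have := Real.rpow_add hq.1 (1 - β) β
        rw [sub_add_cancel, Real.rpow_one] at this
        simp only [tau, hV q.1 q.2 (u q) hq.1 hq.2]
        linear_combination -3 * c₁ / β * this }
  have hXx : EqOn (δx α fun q => -c₁ / α * q.2 ^ α + c₃) (fun _ => -c₁) quadrant := by
    intro q hq
    have h1 := differentiableAt_rpow_snd hq α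
    rw [wd_add (h1.const_mul _) (differentiableAt_const _), wd_const_mul _ h1, wd_const,
      δx_rpow_snd hq]
    simp [hα]
  have hXt : EqOn (δt β fun q => -c₁ / α * q.2 ^ α + c₃) (fun _ => 0) quadrant := by
    intro q hq
    have h1 := differentiableAt_rpow_snd hq α
    rw [wd_add (h1.const_mul _) (differentiableAt_const _), wd_const_mul _ h1, wd_const,
      δt_rpow_snd hq]
    simp
  have hTx : EqOn (δx α fun q => -3 * c₁ / β * q.1 ^ β + c₂) (fun _ => 0) quadrant := by
    intro q hq
    have h1 := differentiableAt_rpow_fst hq β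
    rw [wd_add (h1.const_mul _) (differentiableAt_const _), wd_const_mul _ h1, wd_const,
      δx_rpow_fst hq]
    simp
  have hTt : EqOn (δt β fun q => -3 * c₁ / β * q.1 ^ β + c₂) (fun _ => -3 * c₁) quadrant := by
    intro q hq
    have h1 := differentiableAt_rpow_fst hq β
    rw [wd_add (h1.const_mul _) (differentiableAt_const _), wd_const_mul _ h1, wd_const,
      δt_rpow_fst hq]
    simp [hβ]
  have hXxx : EqOn (δx α (δx α fun q => -c₁ / α * q.2 ^ α + c₃)) (fun _ => 0) quadrant :=
    (wd_congr hO hXx).trans fun q _ => wd_const _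
  have hTxx : EqOn (δx α (δx α fun q => -3 * c₁ / β * q.1 ^ β + c₂)) (fun _ => 0) quadrant :=
    (wd_congr hO hTx).trans fun q _ => wd_const _
  have hus := contDiffOn_δx (α := α) hO Subset.rfl hu.contDiffOn
  have hE1 := δx_const_mul (α := α) hO hu.contDiffOn c₁
  have hE2 := (wd_congr hO hE1).trans (δx_const_mul (α := α) hO hus c₁)
  have hE3 := (wd_congr hO hE2).trans
    (δx_const_mul (α := α) hO (contDiffOn_δx hO Subset.rfl hus) c₁)
  rw [mkdvOp_eqOn hO Subset.rfl hu.contDiffOn hp] at hsol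
  rw [hco.prolongedOp_eq hp, hE3 hp, hE1 hp, wd_congr hO hXxx hp, wd_congr hO hTxx hp, hXxx hp,
    hTxx hp, hXx hp, hTx hp, hXt hp, hTt hp, wd_const,
    wd_const_mul c₁ (hu.differentiable (by simp)).differentiableAt]
  linear_combination 4 * c₁ * hsol

/-! ### The determining equations -/

theorem fderiv_dom_rpow_fst {p : Pt} (hp : p ∈ dom) (r : ℝ) (v : Pt) :
    fderiv ℝ (fun p : Pt => p.1 ^ r) p v = r * p.1 ^ (r - 1) * v.1 := by
  have h := (Real.hasDerivAt_rpow_const (p := r) (Or.inl hp.1.ne')).comp_hasFDerivAt p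
    (hasFDerivAt_fst (𝕜 := ℝ) (E := ℝ) (F := ℝ × ℝ))
  rw [show (fun p : Pt => p.1 ^ r) = (fun x : ℝ => x ^ r) ∘ Prod.fst from rfl, h.fderiv]
  simp

theorem fderiv_dom_rpow_snd {p : Pt} (hp : p ∈ dom) (r : ℝ) (v : Pt) :
    fderiv ℝ (fun p : Pt => p.2.1 ^ r) p v = r * p.2.1 ^ (r - 1) * v.2.1 := by
  have h := (Real.hasDerivAt_rpow_const (p := r) (Or.inl hp.2.ne')).comp_hasFDerivAt p
    ((hasFDerivAt_fst (𝕜 := ℝ) (E := ℝ) (F := ℝ)).comp p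
      (hasFDerivAt_snd (𝕜 := ℝ) (E := ℝ) (F := ℝ × ℝ)))
  rw [show (fun p : Pt => p.2.1 ^ r) = (fun x : ℝ => x ^ r) ∘ (Prod.fst ∘ Prod.snd) from rfl,
    h.fderiv]
  simp

theorem contDiffOn_dT (hG : ContDiffOn ℝ ∞ G dom) : ContDiffOn ℝ ∞ (dT β G) dom :=
  wd_contDiffOn isOpen_dom (contDiffOn_dom_rpow_fst _) hG

theorem contDiffOn_dX (hG : ContDiffOn ℝ ∞ G dom) : ContDiffOn ℝ ∞ (dX α G) dom :=
  wd_contDiffOn isOpen_dom (contDiffOn_dom_rpow_snd _) hG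

theorem contDiffOn_dU (hG : ContDiffOn ℝ ∞ G dom) : ContDiffOn ℝ ∞ (dU G) dom :=
  wd_contDiffOn isOpen_dom contDiffOn_const hG

theorem dU_dX_comm (hG : ContDiffOn ℝ ∞ G dom) : EqOn (dU (dX α G)) (dX α (dU G)) dom :=
  fun _ hp => wd_comm isOpen_dom hG contDiffOn_const (contDiffOn_dom_rpow_snd _)
    (fun y _ => by simp) (fun y hy => by rw [fderiv_dom_rpow_snd hy]; simp) hp

theorem dU_dT_comm (hG : ContDiffOn ℝ ∞ G dom) : EqOn (dU (dT β G)) (dT β (dU G)) dom :=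
  fun _ hp => wd_comm isOpen_dom hG contDiffOn_const (contDiffOn_dom_rpow_fst _)
    (fun y _ => by simp) (fun y hy => by rw [fderiv_dom_rpow_fst hy]; simp) hp

theorem dX_dT_comm (hG : ContDiffOn ℝ ∞ G dom) : EqOn (dX α (dT β G)) (dT β (dX α G)) dom :=
  fun _ hp => wd_comm isOpen_dom hG (contDiffOn_dom_rpow_snd _) (contDiffOn_dom_rpow_fst _)
    (fun y hy => by rw [fderiv_dom_rpow_snd hy]; simp)
    (fun y hy => by rw [fderiv_dom_rpow_fst hy]; simp) hp

theorem hasFDerivAt_along (hu : DifferentiableAt ℝ u q)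
    (hG : DifferentiableAt ℝ G (q.1, q.2, u q)) :
    HasFDerivAt (along G u) ((fderiv ℝ G (q.1, q.2, u q)).comp
      ((ContinuousLinearMap.fst ℝ ℝ ℝ).prod ((ContinuousLinearMap.snd ℝ ℝ ℝ).prod
        (fderiv ℝ u q)))) q :=
  HasFDerivAt.comp (g := G) (f := fun q : ℝ × ℝ => ((q.1, q.2, u q) : Pt)) q hG.hasFDerivAt
    (hasFDerivAt_fst.prodMk (hasFDerivAt_snd.prodMk hu.hasFDerivAt))

theorem hasWd_x_along (hN : IsOpen N) (hNq : N ⊆ quadrant) (hu : ContDiffOn ℝ ∞ u N)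
    (hG : ContDiffOn ℝ ∞ G dom) (hq : q ∈ N) :
    HasWd (fun q : ℝ × ℝ => q.2 ^ (1 - α)) (0, 1) (along G u)
      (along (dX α G) u q + δx α u q * along (dU G) u q) q := by
  have h := hasFDerivAt_along (hu.differentiableAt_of_isOpen hN hq)
    (hG.differentiableAt_of_isOpen isOpen_dom (by exact hNq hq))
  refine ⟨h.differentiableAt, ?_⟩
  have hv : (((0 : ℝ), (1 : ℝ), fderiv ℝ u q (0, 1)) : Pt) =
    (0, 1, 0) + fderiv ℝ u q (0, 1) • (0, 0, 1) := by simp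
  simp only [wd, h.fderiv, along, ContinuousLinearMap.comp_apply, ContinuousLinearMap.prod_apply,
    ContinuousLinearMap.coe_fst', ContinuousLinearMap.coe_snd', hv, map_add, map_smul, smul_eq_mul]
  ring

theorem δt_along (hN : IsOpen N) (hNq : N ⊆ quadrant) (hu : ContDiffOn ℝ ∞ u N)
    (hG : ContDiffOn ℝ ∞ G dom) (hq : q ∈ N) :
    δt β (along G u) q = along (dT β G) u q + δt β u q * along (dU G) u q := by
  have h := hasFDerivAt_along (hu.differentiableAt_of_isOpen hN hq)
    (hG.differentiableAt_of_isOpen isOpen_dom (by exact hNq hq))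
  have hv : (((1 : ℝ), (0 : ℝ), fderiv ℝ u q (1, 0)) : Pt) =
    (1, 0, 0) + fderiv ℝ u q (1, 0) • (0, 0, 1) := by simp
  simp only [wd, h.fderiv, along, ContinuousLinearMap.comp_apply, ContinuousLinearMap.prod_apply,
    ContinuousLinearMap.coe_fst', ContinuousLinearMap.coe_snd', hv, map_add, map_smul, smul_eq_mul]
  ring

theorem along_congr (hN : N ⊆ quadrant) (h : EqOn G H dom) : EqOn (along G u) (along H u) N :=
  fun _ hq => h (hN hq)

theorem δx_δx_along (hN : IsOpen N) (hNq : N ⊆ quadrant) (hu : ContDiffOn ℝ ∞ u N)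
    (hG : ContDiffOn ℝ ∞ G dom) :
    EqOn (δx α (δx α (along G u))) (fun q => along (dX α (dX α G)) u q
      + 2 * (δx α u q * along (dX α (dU G)) u q)
      + δx α u q * δx α u q * along (dU (dU G)) u q
      + δx α (δx α u) q * along (dU G) u q) N := by
  intro q hq
  have hX := contDiffOn_dX (α := α) hG
  have hU := contDiffOn_dU hG
  have hus := (contDiffOn_δx (α := α) hN hNq hu).hasWd
    (w := fun q : ℝ × ℝ => q.2 ^ (1 - α)) (v := (0, 1)) hN hq
  rw [wd_congr hN (fun q hq => (hasWd_x_along hN hNq hu hG hq).2) hq,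
    ((hasWd_x_along hN hNq hu hX hq).add (hus.mul (hasWd_x_along hN hNq hu hU hq))).2,
    along_congr hNq (dU_dX_comm hG) hq]
  ring

/-- The third-order chain rule; commutation of `∂/∂u` with the weighted `x`-derivation collects the
mixed terms. -/
theorem δx_δx_δx_along (hN : IsOpen N) (hNq : N ⊆ quadrant) (hu : ContDiffOn ℝ ∞ u N)
    (hG : ContDiffOn ℝ ∞ G dom) (hq : q ∈ N) :
    δx α (δx α (δx α (along G u))) q = along (dX α (dX α (dX α G))) u q
      + 3 * δx α u q * along (dX α (dX α (dU G))) u q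
      + 3 * δx α u q ^ 2 * along (dX α (dU (dU G))) u q
      + δx α u q ^ 3 * along (dU (dU (dU G))) u q
      + 3 * δx α (δx α u) q * along (dX α (dU G)) u q
      + 3 * δx α u q * δx α (δx α u) q * along (dU (dU G)) u q
      + δx α (δx α (δx α u)) q * along (dU G) u q := by
  have hX := contDiffOn_dX (α := α) hG
  have hU := contDiffOn_dU hG
  have hd : ∀ {f : ℝ × ℝ → ℝ}, ContDiffOn ℝ ∞ f N → HasWd (fun q : ℝ × ℝ => q.2 ^ (1 - α)) (0, 1)
    f (δx α f q) q := fun hf => hf.hasWd hN hq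
  have ha := contDiffOn_δx (α := α) hN hNq hu
  have hb := contDiffOn_δx (α := α) hN hNq ha
  have hA : ∀ {G : Pt → ℝ}, ContDiffOn ℝ ∞ G dom → HasWd (fun q : ℝ × ℝ => q.2 ^ (1 - α)) (0, 1)
    (along G u) (along (dX α G) u q + δx α u q * along (dU G) u q) q :=
    fun hG => hasWd_x_along hN hNq hu hG hq
  rw [wd_congr hN (δx_δx_along hN hNq hu hG) hq,
    ((((hA (contDiffOn_dX hX)).add (((hd ha).mul (hA (contDiffOn_dX hU))).const_mul 2)).add
      (((hd ha).mul (hd ha)).mul (hA (contDiffOn_dU hU)))).add ((hd hb).mul (hA hU))).2,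
    along_congr hNq (dU_dX_comm hX) hq,
    along_congr hNq (wd_congr isOpen_dom (dU_dX_comm hG)) hq,
    along_congr hNq (dU_dX_comm hU) hq]
  ring

/-- The derivative `δt` of `G` along a function with `δt u = -c a`, `δx u = a`. -/
def jetT (β : ℝ) (G : Pt → ℝ) (P : Pt) (a c : ℝ) : ℝ := dT β G P - c * a * dU G P

/-- The derivative `δx` of `G` along a function with `δx u = a`. -/
def jetX (α : ℝ) (G : Pt → ℝ) (P : Pt) (a : ℝ) : ℝ := dX α G P + a * dU G P

/-- The second derivative of `G` along a function with first derivatives `a`, `b`. -/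
def jetXX (α : ℝ) (G : Pt → ℝ) (P : Pt) (a b : ℝ) : ℝ :=
  dX α (dX α G) P + 2 * a * dX α (dU G) P + a ^ 2 * dU (dU G) P + b * dU G P

/-- The third derivative of `G` along a function with first derivatives `a`, `b`, `d`. -/
def jetXXX (α : ℝ) (G : Pt → ℝ) (P : Pt) (a b d : ℝ) : ℝ :=
  dX α (dX α (dX α G)) P + 3 * a * dX α (dX α (dU G)) P + 3 * a ^ 2 * dX α (dU (dU G)) P
    + a ^ 3 * dU (dU (dU G)) P + 3 * b * dX α (dU G) P + 3 * a * b * dU (dU G) P + d * dU G P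

/-- The linearized symmetry condition in terms of the jets of the coefficients of the vector
field and of the parameters `a`, `b`, `c` of the travelling wave. -/
theorem WaveCondition.jet_eq (hα : α ≠ 0) (hβ : β ≠ 0) (hV : ContDiffOn ℝ ∞ V dom)
    (h : WaveCondition α β V) {P : Pt} (hP : P ∈ dom) {A B C : Pt → ℝ} (hA : etaC V = A)
    (hB : xiC α V = B) (hC : tauC β V = C) (a b c : ℝ) :
    jetT β A P a c - 12 * P.2.2 * a * A P - 6 * P.2.2 ^ 2 * jetX α A P a
      + jetXXX α A P a b ((6 * P.2.2 ^ 2 + c) * a)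
      - a * (jetT β B P a c - c * jetT β C P a c)
      - (12 * P.2.2 ^ 2 + 3 * c) * a * (jetX α B P a - c * jetX α C P a)
      - 3 * b * (jetXX α B P a b - c * jetXX α C P a b)
      - a * (jetXXX α B P a b ((6 * P.2.2 ^ 2 + c) * a)
        - c * jetXXX α C P a b ((6 * P.2.2 ^ 2 + c) * a)) = 0 := by
  obtain ⟨t, x, k⟩ := P
  obtain ⟨u, N, hu, hw, hpN, hk, ha, hb⟩ :=
    exists_isWaveOn (p := (t, x)) hα hβ hP c k a b
  have key := h c u N hu hw _ hpN
  have hAs := contDiffOn_etaC hV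
  have hBs := contDiffOn_xiC (α := α) hV
  have hCs := contDiffOn_tauC (β := β) hV
  rw [hA] at hAs key
  rw [hB] at hBs key
  rw [hC] at hCs key
  have hal : ∀ G : Pt → ℝ, along G u (t, x) = G (t, x, k) := fun G => by rw [along, hk]
  have ho := hw.isOpen
  have hs := hw.subset
  have hus := hw.smooth
  have h1 : ∀ {G : Pt → ℝ}, ContDiffOn ℝ ∞ G dom →
      δx α (along G u) (t, x) = jetX α G (t, x, k) a := fun hG => by
    rw [(hasWd_x_along ho hs hus hG hpN).2, hal, hal, ha, jetX]
  have h2 : ∀ {G : Pt → ℝ}, ContDiffOn ℝ ∞ G dom →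
      δx α (δx α (along G u)) (t, x) = jetXX α G (t, x, k) a b := fun hG => by
    rw [δx_δx_along ho hs hus hG hpN]
    simp only [hal, ha, hb, jetXX]
    ring
  have h3 : ∀ {G : Pt → ℝ}, ContDiffOn ℝ ∞ G dom →
      δx α (δx α (δx α (along G u))) (t, x) = jetXXX α G (t, x, k) a b ((6 * k ^ 2 + c) * a) :=
    fun hG => by
      rw [δx_δx_δx_along ho hs hus hG hpN, hw.δx_three _ hpN]
      simp only [hal, ha, hb, hk, jetXXX]
  have h4 : ∀ {G : Pt → ℝ}, ContDiffOn ℝ ∞ G dom →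
      δt β (along G u) (t, x) = jetT β G (t, x, k) a c := fun hG => by
    rw [δt_along ho hs hus hG hpN, hw.δt_eq _ hpN, hal, hal, ha, jetT]
    ring
  rw [waveOp, h1 hAs, h1 hBs, h1 hCs, h2 hBs, h2 hCs, h3 hAs, h3 hBs, h3 hCs, h4 hAs, h4 hBs,
    h4 hCs, hal, hk, ha, hb] at key
  linear_combination key

/-! ### Integration of the determining equations. -/

/-- The weights do not vanish, so the full derivative is zero, and `dom` is connected as a product
of intervals. -/
theorem exists_const_of_wd_eq_zero (hG : ContDiffOn ℝ ∞ G dom) (hT : ∀ p ∈ dom, dT β G p = 0)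
    (hX : ∀ p ∈ dom, dX α G p = 0) (hU : ∀ p ∈ dom, dU G p = 0) :
    ∃ c, ∀ p ∈ dom, G p = c := by
  have hconv : IsPreconnected dom := by
    have : dom = Ioi (0 : ℝ) ×ˢ (Ioi (0 : ℝ) ×ˢ univ) := by
      ext p; simp [dom]
    rw [this]
    exact isPreconnected_Ioi.prod (isPreconnected_Ioi.prod isPreconnected_univ)
  refine ⟨G (1, 1, 0), fun p hp => isOpen_dom.is_const_of_fderiv_eq_zero (𝕜 := ℝ) hconv
    (hG.differentiableOn (by simp)) (fun p hp => ?_) hp (by simp [dom])⟩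
  have h1 : fderiv ℝ G p (1, 0) = 0 :=
    (mul_eq_zero.1 (hT p hp)).resolve_left (Real.rpow_pos_of_pos hp.1 _).ne'
  have h2 : fderiv ℝ G p (0, 1, 0) = 0 :=
    (mul_eq_zero.1 (hX p hp)).resolve_left (Real.rpow_pos_of_pos hp.2 _).ne'
  have h3 : fderiv ℝ G p (0, 0, 1) = 0 := (mul_eq_zero.1 (hU p hp)).resolve_left one_ne_zero
  ext <;> simp [h1, h2, h3]

theorem eq_of_dU_eq_zero (hG : ContDiffOn ℝ ∞ G dom) (hU : ∀ p ∈ dom, dU G p = 0) {t x : ℝ}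
    (ht : 0 < t) (hx : 0 < x) (u v : ℝ) : G (t, x, u) = G (t, x, v) := by
  have h : ∀ s : ℝ, HasDerivAt (fun s => G (t, x, s)) 0 s := fun s => by
    have hp : ((t, x, s) : Pt) ∈ dom := ⟨ht, hx⟩
    have h1 : HasDerivAt (fun s : ℝ => ((t, x, s) : Pt)) (0, 0, 1) s :=
      (hasDerivAt_const _ _).prodMk ((hasDerivAt_const _ _).prodMk (hasDerivAt_id _))
    have h2 := HasFDerivAt.comp_hasDerivAt (f := fun s : ℝ => ((t, x, s) : Pt)) s
      (hG.differentiableAt_of_isOpen isOpen_dom hp).hasFDerivAt h1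
    have h3 : fderiv ℝ G (t, x, s) (0, 0, 1) = 0 :=
      (mul_eq_zero.1 (hU _ hp)).resolve_left one_ne_zero
    rwa [h3] at h2
  exact is_const_of_deriv_eq_zero (fun s => (h s).differentiableAt) (fun s => (h s).deriv) u v

/-- Write `A`, `B`, `C` for the coefficients of `∂/∂u` and of the two weighted derivations. Finite
differences in `a`, `b`, `c` extract the coefficients of the jet identity. They force `B` and `C` to
be independent of `u`, `C` of `x`, then `C_T = 3 B_X`, `B_T = 0` and `A = -u B_X` with `B_X`
constant. -/
theorem WaveCondition.isClassified (hα : α ≠ 0) (hβ : β ≠ 0) (hV : ContDiffOn ℝ ∞ V dom)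
    (h : WaveCondition α β V) : IsClassified α β V := by
  obtain ⟨A, hA⟩ : ∃ A, etaC V = A := ⟨_, rfl⟩
  obtain ⟨B, hB⟩ : ∃ B, xiC α V = B := ⟨_, rfl⟩
  obtain ⟨C, hC⟩ : ∃ C, tauC β V = C := ⟨_, rfl⟩
  have hAs : ContDiffOn ℝ ∞ A dom := hA ▸ contDiffOn_etaC hV
  have hBs : ContDiffOn ℝ ∞ B dom := hB ▸ contDiffOn_xiC hV
  have hCs : ContDiffOn ℝ ∞ C dom := hC ▸ contDiffOn_tauC hV
  have key := fun (P : Pt) (hP : P ∈ dom) => h.jet_eq hα hβ hV hP hA hB hC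
  simp only [jetT, jetX, jetXX, jetXXX] at key
  have hO := isOpen_dom
  -- The coefficient of `b²` at `a = c = 0` is `-3 B_u`.
  have BU : EqOn (dU B) (fun _ => 0) dom := fun P hP => by
    linear_combination (-1 / 6) * (key P hP 0 1 0 + key P hP 0 (-1) 0 - 2 * key P hP 0 0 0)
  -- The coefficient of `b²` at `a = 0`, `c = 1` is `-3 (B_u - C_u)`.
  have CU : EqOn (dU C) (fun _ => 0) dom := fun P hP => by
    linear_combination (1 / 6) * (key P hP 0 1 1 + key P hP 0 (-1) 1 - 2 * key P hP 0 0 1)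
      + BU hP
  have zero : ∀ {w : Pt → ℝ} {v : Pt} {G : Pt → ℝ}, EqOn G (fun _ => 0) dom →
      EqOn (wd w v G) (fun _ => 0) dom := fun hG => (wd_congr hO hG).trans fun _ _ => wd_const _
  -- The part odd in `b`, compared at `a = 1` and `a = 0` with `c = 0`, gives `A_uu` up to
  -- derivatives of `B_u`.
  have AUU : EqOn (dU (dU A)) (fun _ => 0) dom := fun P hP => by
    linear_combination (1 / 6) * (key P hP 1 1 0 - key P hP 1 (-1) 0
      - key P hP 0 1 0 + key P hP 0 (-1) 0) + 3 * zero (w := fun p => p.2.1 ^ (1 - α))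
        (v := ((0 : ℝ), (1 : ℝ), (0 : ℝ))) BU hP
      + 2 * zero (w := fun _ => 1) (v := ((0 : ℝ), (0 : ℝ), (1 : ℝ))) BU hP
  -- At `a = 1`, `b = 0` the coefficient of `c²` is `3 (C_X + C_u)`.
  have CX : EqOn (dX α C) (fun _ => 0) dom := fun P hP => by
    linear_combination (1 / 6) * (key P hP 1 0 1 + key P hP 1 0 (-1) - 2 * key P hP 1 0 0)
      - CU hP
  have zX : ∀ {G : Pt → ℝ}, EqOn G (fun _ => 0) dom → EqOn (dX α G) (fun _ => 0) dom := zero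
  have zU : ∀ {G : Pt → ℝ}, EqOn G (fun _ => 0) dom → EqOn (dU G) (fun _ => 0) dom := zero
  have zT : ∀ {G : Pt → ℝ}, EqOn G (fun _ => 0) dom → EqOn (dT β G) (fun _ => 0) dom := zero
  -- What is left is affine in `a` and `b`, up to a term in `a c`. The terms in `A_u` cancel by the
  -- profile equation.
  have key' : ∀ P ∈ dom, ∀ a b c : ℝ, dT β A P - 12 * P.2.2 * a * A P - 6 * P.2.2 ^ 2 * dX α A P
      + dX α (dX α (dX α A)) P + 3 * a * dX α (dX α (dU A)) P + 3 * b * dX α (dU A) P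
      - a * (dT β B P - c * dT β C P) - (12 * P.2.2 ^ 2 + 3 * c) * a * dX α B P
      - 3 * b * dX α (dX α B) P - a * dX α (dX α (dX α B)) P = 0 := fun P hP a b c => by
    have k := key P hP a b c
    simp only [BU hP, CU hP, zX BU hP, zX CU hP, zU BU hP, zU CU hP, zX (zX BU) hP,
      zX (zX CU) hP, zX (zU BU) hP, zX (zU CU) hP, zU (zU BU) hP, zU (zU CU) hP, CX hP,
      zX CX hP, zX (zX CX) hP, AUU hP, zX AUU hP, zU AUU hP] at k
    linear_combination k
  clear key
  have CT : EqOn (dT β C) (fun p => 3 * dX α B p) dom := fun P hP => by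
    linear_combination (1 / 2) * (key' P hP 1 0 1 - key' P hP 1 0 (-1))
  have BXs := contDiffOn_dX (α := α) hBs
  -- Since `C_X = 0` and the derivations commute, `0 = C_TX = 3 B_XX`.
  have BXX : EqOn (dX α (dX α B)) (fun _ => 0) dom := fun P hP => by
    have h1 := dX_dT_comm (α := α) (β := β) hCs hP
    rw [zT CX hP, wd_congr hO CT hP, wd_const_mul _ (BXs.differentiableAt_of_isOpen hO hP)] at h1
    linear_combination (1 / 3) * h1
  have AUX : EqOn (dX α (dU A)) (fun _ => 0) dom := fun P hP => by
    linear_combination (1 / 6) * (key' P hP 0 1 0 - key' P hP 0 (-1) 0) + BXX hP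
  -- The coefficient of `a` at `b = c = 0`, where `A_uXX` and `B_XXX` vanish by the preceding
  -- equations.
  have main : ∀ P ∈ dom, dT β B P + 12 * P.2.2 * (A P + P.2.2 * dX α B P) = 0 := fun P hP => by
    linear_combination (-1 / 2) * (key' P hP 1 0 0 - key' P hP (-1) 0 0) + 3 * zX AUX hP
      - zX BXX hP
  -- `B_T` does not depend on `u`, and `main` at `u = 0` makes it vanish.
  have BT : EqOn (dT β B) (fun _ => 0) dom := by
    rintro ⟨t, x, k⟩ hP
    rw [eq_of_dU_eq_zero (contDiffOn_dT hBs) (fun p hp => (dU_dT_comm hBs hp).trans (zT BU hp))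
      hP.1 hP.2 k 0]
    simpa using main (t, x, 0) hP
  obtain ⟨c₀, hc₀⟩ := exists_const_of_wd_eq_zero BXs
    (fun p hp => (dX_dT_comm (β := β) hBs hp).symm.trans (zX BT hp)) BXX
    (fun p hp => (dU_dX_comm hBs hp).trans (zX BU hp))
  have hx := contDiffOn_dom_rpow_snd α
  have ht := contDiffOn_dom_rpow_fst β
  have dx : ∀ p ∈ dom, DifferentiableAt ℝ (fun p : Pt => p.2.1 ^ α) p := fun p hp =>
    hx.differentiableAt_of_isOpen hO hp
  have dt : ∀ p ∈ dom, DifferentiableAt ℝ (fun p : Pt => p.1 ^ β) p := fun p hp =>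
    ht.differentiableAt_of_isOpen hO hp
  have dB : ∀ p ∈ dom, DifferentiableAt ℝ B p := fun p hp => hBs.differentiableAt_of_isOpen hO hp
  have dC : ∀ p ∈ dom, DifferentiableAt ℝ C p := fun p hp => hCs.differentiableAt_of_isOpen hO hp
  obtain ⟨c₃, hc₃⟩ := exists_const_of_wd_eq_zero (α := α) (β := β)
    (G := fun p => B p - c₀ / α * p.2.1 ^ α) (hBs.sub (contDiffOn_const.mul hx))
    (fun p hp => by
      rw [wd_sub (dB p hp) ((dx p hp).const_mul _), wd_const_mul _ (dx p hp), BT hp, wd,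
        fderiv_dom_rpow_snd hp]
      simp)
    (fun p hp => by
      rw [wd_sub (dB p hp) ((dx p hp).const_mul _), wd_const_mul _ (dx p hp), hc₀ p hp, wd,
        fderiv_dom_rpow_snd hp]
      have h1 := rpow_sub_one_mul hp.2 α
      field_simp
      linear_combination -c₀ * h1)
    (fun p hp => by
      rw [wd_sub (dB p hp) ((dx p hp).const_mul _), wd_const_mul _ (dx p hp), BU hp, wd,
        fderiv_dom_rpow_snd hp]
      simp)
  obtain ⟨c₂, hc₂⟩ := exists_const_of_wd_eq_zero (α := α) (β := β)
    (G := fun p => C p - 3 * c₀ / β * p.1 ^ β) (hCs.sub (contDiffOn_const.mul ht))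
    (fun p hp => by
      have h2 : dT β C p = 3 * c₀ := (CT hp).trans (by simp only [hc₀ p hp])
      rw [wd_sub (dC p hp) ((dt p hp).const_mul _), wd_const_mul _ (dt p hp), h2, wd,
        fderiv_dom_rpow_fst hp]
      have h1 := rpow_sub_one_mul hp.1 β
      field_simp
      linear_combination -3 * c₀ * h1)
    (fun p hp => by
      rw [wd_sub (dC p hp) ((dt p hp).const_mul _), wd_const_mul _ (dt p hp), CX hp, wd,
        fderiv_dom_rpow_fst hp]
      simp)
    (fun p hp => by
      rw [wd_sub (dC p hp) ((dt p hp).const_mul _), wd_const_mul _ (dt p hp), CU hp, wd,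
        fderiv_dom_rpow_fst hp]
      simp)
  -- Now `main` reads `u (A + u c₀) = 0`. This determines `A` for `u ≠ 0`, and continuity extends
  -- the formula to `u = 0`.
  have hAe : ∀ t x : ℝ, 0 < t → 0 < x → ∀ k, A (t, x, k) = -c₀ * k := by
    intro t x ht hx
    have hc : Continuous fun k : ℝ => A (t, x, k) :=
      hAs.continuousOn.comp_continuous (by fun_prop) fun k => ⟨ht, hx⟩
    refine congr_fun (Continuous.ext_on (dense_compl_singleton (0 : ℝ)) hc (by fun_prop) ?_)
    intro k hk
    have h1 := main (t, x, k) ⟨ht, hx⟩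
    rw [BT ⟨ht, hx⟩, hc₀ _ ⟨ht, hx⟩] at h1
    have h2 : k * (A (t, x, k) + k * c₀) = 0 := by linear_combination h1 / 12
    linear_combination (mul_eq_zero.1 h2).resolve_left hk
  refine ⟨-c₀, c₂, c₃, fun t x u ht hx => ?_⟩
  have hp : ((t, x, u) : Pt) ∈ dom := ⟨ht, hx⟩
  have h1 := hc₂ _ hp
  have h2 := hc₃ _ hp
  have h3 := hAe t x ht hx u
  rw [← hC] at h1
  rw [← hB] at h2
  rw [← hA] at h3
  simp only [tauC, xiC, etaC] at h1 h2 h3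
  have r1 := rpow_sub_one_mul ht β
  have r2 := rpow_sub_one_mul hx α
  have s1 := Real.rpow_add ht (1 - β) β
  have s2 := Real.rpow_add hx (1 - α) α
  rw [sub_add_cancel, Real.rpow_one] at s1 s2
  refine Prod.ext ?_ (Prod.ext ?_ h3)
  · linear_combination t ^ (1 - β) * h1 - (V (t, x, u)).1 * r1 - 3 * c₀ / β * s1
  · linear_combination x ^ (1 - α) * h2 - (V (t, x, u)).2.1 * r2 - c₀ / α * s2

/-! ### One-parameter families of functions -/

/-- The derivation `∂/∂ε` of functions of `(ε, t, x)`. -/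
local notation:max "sE" => wd (fun _ : ℝ × ℝ × ℝ => (1 : ℝ)) ((1 : ℝ), (0 : ℝ), (0 : ℝ))

/-- The derivation `t ^ (1 - β) ∂/∂t` of functions of `(ε, t, x)`. -/
local notation:max "sT" β:max =>
  wd (fun z : ℝ × ℝ × ℝ => Prod.fst (Prod.snd z) ^ (1 - β)) ((0 : ℝ), (1 : ℝ), (0 : ℝ))

/-- The derivation `x ^ (1 - α) ∂/∂x` of functions of `(ε, t, x)`. -/
local notation:max "sX" α:max =>
  wd (fun z : ℝ × ℝ × ℝ => Prod.snd (Prod.snd z) ^ (1 - α)) ((0 : ℝ), (0 : ℝ), (1 : ℝ))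

theorem fderiv_slice {K : ℝ × ℝ × ℝ → ℝ} {ε : ℝ} (hK : DifferentiableAt ℝ K (ε, q))
    (v : ℝ × ℝ) : fderiv ℝ (fun q => K (ε, q)) q v = fderiv ℝ K (ε, q) (0, v) := by
  have h := HasFDerivAt.comp (f := fun q : ℝ × ℝ => (ε, q)) q hK.hasFDerivAt
    (hasFDerivAt_prodMk_right ε q)
  rw [show (fun q => K (ε, q)) = K ∘ fun q : ℝ × ℝ => (ε, q) from rfl, h.fderiv]
  simp

theorem isOpen_slice {O : Set (ℝ × ℝ × ℝ)} (hO : IsOpen O) (ε : ℝ) :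
    IsOpen {q : ℝ × ℝ | (ε, q) ∈ O} := hO.preimage (by fun_prop)

section Deformation

variable {O : Set (ℝ × ℝ × ℝ)} {K U : ℝ × ℝ × ℝ → ℝ}

theorem contDiffOn_slice (hK : ContDiffOn ℝ ∞ K O) (ε : ℝ) :
    ContDiffOn ℝ ∞ (fun q => K (ε, q)) {q | (ε, q) ∈ O} :=
  hK.comp (by fun_prop) fun _ hq => hq

theorem δx_slice (hO : IsOpen O) (hK : ContDiffOn ℝ ∞ K O) (ε : ℝ) :
    EqOn (δx α fun q => K (ε, q)) (fun q => sX α K (ε, q)) {q | (ε, q) ∈ O} := fun _ hq => by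
  simp only [wd, fderiv_slice (hK.differentiableAt_of_isOpen hO hq)]

theorem δt_slice (hO : IsOpen O) (hK : ContDiffOn ℝ ∞ K O) (ε : ℝ) :
    EqOn (δt β fun q => K (ε, q)) (fun q => sT β K (ε, q)) {q | (ε, q) ∈ O} := fun _ hq => by
  simp only [wd, fderiv_slice (hK.differentiableAt_of_isOpen hO hq)]

theorem contDiffOn_weight_t (hOq : ∀ z ∈ O, z.2 ∈ quadrant) (r : ℝ) :
    ContDiffOn ℝ ∞ (fun z : ℝ × ℝ × ℝ => z.2.1 ^ r) O :=
  (contDiffOn_rpow_fst Subset.rfl r).comp contDiffOn_snd hOq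

theorem contDiffOn_weight_x (hOq : ∀ z ∈ O, z.2 ∈ quadrant) (r : ℝ) :
    ContDiffOn ℝ ∞ (fun z : ℝ × ℝ × ℝ => z.2.2 ^ r) O :=
  (contDiffOn_rpow_snd Subset.rfl r).comp contDiffOn_snd hOq

theorem contDiffOn_sX (hO : IsOpen O) (hOq : ∀ z ∈ O, z.2 ∈ quadrant) (hK : ContDiffOn ℝ ∞ K O) :
    ContDiffOn ℝ ∞ (sX α K) O := wd_contDiffOn hO (contDiffOn_weight_x hOq _) hK

theorem fderiv_comp_snd_apply {h : ℝ × ℝ → ℝ} {z : ℝ × ℝ × ℝ} (hh : DifferentiableAt ℝ h z.2) :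
    fderiv ℝ (fun z : ℝ × ℝ × ℝ => h z.2) z (1, 0, 0) = 0 := by
  have := HasFDerivAt.comp (f := fun z : ℝ × ℝ × ℝ => z.2) z hh.hasFDerivAt hasFDerivAt_snd
  rw [show (fun z : ℝ × ℝ × ℝ => h z.2) = h ∘ fun z : ℝ × ℝ × ℝ => z.2 from rfl, this.fderiv]
  change fderiv ℝ h z.2 (0, 0) = 0
  rw [Prod.mk_zero_zero, map_zero]

theorem sE_sX_comm (hO : IsOpen O) (hOq : ∀ z ∈ O, z.2 ∈ quadrant) (hK : ContDiffOn ℝ ∞ K O) :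
    EqOn (sE (sX α K)) (sX α (sE K)) O := fun _ hz =>
  wd_comm hO hK contDiffOn_const (contDiffOn_weight_x hOq _) (fun y _ => by simp)
    (fun _ hy => fderiv_comp_snd_apply (differentiableAt_rpow_snd (hOq _ hy) _)) hz

theorem sE_sT_comm (hO : IsOpen O) (hOq : ∀ z ∈ O, z.2 ∈ quadrant) (hK : ContDiffOn ℝ ∞ K O) :
    EqOn (sE (sT β K)) (sT β (sE K)) O := fun _ hz =>
  wd_comm hO hK contDiffOn_const (contDiffOn_weight_t hOq _) (fun y _ => by simp)
    (fun _ hy => fderiv_comp_snd_apply (differentiableAt_rpow_fst (hOq _ hy) _)) hz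

theorem mkdvOp_slice (hO : IsOpen O) (hOq : ∀ z ∈ O, z.2 ∈ quadrant) (hU : ContDiffOn ℝ ∞ U O)
    {ε : ℝ} (hq : (ε, q) ∈ O) : mkdvOp α β (fun q => U (ε, q)) q =
      sT β U (ε, q) - 6 * (U (ε, q) * U (ε, q)) * sX α U (ε, q) + sX α (sX α (sX α U)) (ε, q) := by
  have hs := isOpen_slice hO ε
  have h1 := contDiffOn_sX (α := α) hO hOq hU
  have h2 := contDiffOn_sX (α := α) hO hOq h1
  rw [mkdvOp_eqOn hs (fun q hq => hOq _ hq) (contDiffOn_slice hU ε) hq]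
  beta_reduce
  rw [δt_slice hO hU ε hq, δx_slice hO hU ε hq,
    ((wd_congr hs ((wd_congr hs (δx_slice hO hU ε)).trans (δx_slice hO h1 ε))).trans
      (δx_slice hO h2 ε)) hq]
  ring

/-- Differentiating a one-parameter family of solutions gives a solution of the linearized
equation. -/
theorem linearizedOp_eq_zero_of_family {Q : ℝ × ℝ → ℝ} (hO : IsOpen O)
    (hOq : ∀ z ∈ O, z.2 ∈ quadrant) (hU : ContDiffOn ℝ ∞ U O)
    (hsol : ∀ z ∈ O, mkdvOp α β (fun q => U (z.1, q)) z.2 = 0)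
    (hu : ∀ q, ((0 : ℝ), q) ∈ O → U (0, q) = u q)
    (hQ : ∀ q, ((0 : ℝ), q) ∈ O → fderiv ℝ U (0, q) (1, 0, 0) = Q q)
    (hq : ((0 : ℝ), q) ∈ O) : linearizedOp α β u Q q = 0 := by
  have hs := isOpen_slice hO 0
  have h1 := contDiffOn_sX (α := α) hO hOq hU
  have h2 := contDiffOn_sX (α := α) hO hOq h1
  have h3 := contDiffOn_sX (α := α) hO hOq h2
  have ht : ContDiffOn ℝ ∞ (sT β U) O := wd_contDiffOn hO (contDiffOn_weight_t hOq _) hU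
  have hE : ContDiffOn ℝ ∞ (sE U) O := wd_contDiffOn hO contDiffOn_const hU
  have hE1 := contDiffOn_sX (α := α) hO hOq hE
  have hE2 := contDiffOn_sX (α := α) hO hOq hE1
  -- The family consists of solutions, so this function vanishes identically on `O`; `key` is its
  -- `ε`-derivative.
  have hF : EqOn (fun z => sT β U z - 6 * (U z * U z) * sX α U z + sX α (sX α (sX α U)) z)
      (fun _ => 0) O := fun z hz => (mkdvOp_slice hO hOq hU hz).symm.trans (hsol z hz)
  have hd : ∀ {f : ℝ × ℝ × ℝ → ℝ}, ContDiffOn ℝ ∞ f O →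
      HasWd (fun _ : ℝ × ℝ × ℝ => (1 : ℝ)) (1, 0, 0) f (sE f (0, q)) (0, q) :=
    fun hf => hf.hasWd hO hq
  have key := (((hd ht).sub ((((hd hU).mul (hd hU)).const_mul 6).mul (hd h1))).add (hd h3)).2
  rw [wd_congr hO hF hq, wd_const, sE_sT_comm hO hOq hU hq, sE_sX_comm hO hOq hU hq,
    ((sE_sX_comm hO hOq h2).trans (wd_congr hO ((sE_sX_comm hO hOq h1).trans
      (wd_congr hO (sE_sX_comm hO hOq hU))))) hq] at key
  have eu : EqOn u (fun q => U (0, q)) {q | ((0 : ℝ), q) ∈ O} := fun q hq => (hu q hq).symm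
  have eQ : EqOn Q (fun q => sE U (0, q)) {q | ((0 : ℝ), q) ∈ O} := fun q hq => by
    simp only [wd, hQ q hq, one_mul]
  have x1 := (wd_congr hs eQ).trans (δx_slice (α := α) hO hE 0)
  have x2 := (wd_congr hs x1).trans (δx_slice (α := α) hO hE1 0)
  have x3 := (wd_congr hs x2).trans (δx_slice (α := α) hO hE2 0)
  rw [linearizedOp, ((wd_congr hs eQ).trans (δt_slice (β := β) hO hE 0)) hq, x3 hq, x1 hq, eu hq,
    eQ hq, ((wd_congr hs eu).trans (δx_slice (α := α) hO hU 0)) hq]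
  linear_combination -key

end Deformation

/-! ### Deforming a function by a local flow -/

/-- Invertibility of the derivative is an open condition. It makes the local inverse smooth on a
whole neighbourhood, not only at one point. -/
theorem eventually_range_equiv {E : Type*} [NormedAddCommGroup E] [NormedSpace ℝ E]
    [CompleteSpace E] {G : E → E} {O : Set E} {z : E} (hO : IsOpen O) (hz : z ∈ O)
    (hG : ContDiffOn ℝ ∞ G O) {e : E ≃L[ℝ] E} (he : fderiv ℝ G z = e) :
    ∀ᶠ y in 𝓝 z, ∃ e' : E ≃L[ℝ] E, fderiv ℝ G y = e' := by
  have hc : ContinuousAt (fderiv ℝ G) z :=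
    ((hG.fderiv_of_isOpen (m := ∞) hO (by simp)).continuousOn).continuousAt (hO.mem_nhds hz)
  have h := hc.eventually_mem (by rw [he]; exact e.nhds)
  filter_upwards [h] with y hy
  exact ⟨hy.choose, hy.choose_spec.symm⟩

/-- A smooth map on an open set has a smooth local inverse near a point where its derivative is
invertible. -/
theorem exists_smooth_localInverse {E : Type*} [NormedAddCommGroup E] [NormedSpace ℝ E]
    [CompleteSpace E] {G : E → E} {O : Set E} {z : E} (hO : IsOpen O) (hz : z ∈ O)
    (hG : ContDiffOn ℝ ∞ G O) {e : E ≃L[ℝ] E} (he : fderiv ℝ G z = e) :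
    ∃ (A B : Set E) (H : E → E), IsOpen A ∧ IsOpen B ∧ z ∈ A ∧ A ⊆ O ∧ MapsTo G A B ∧
      MapsTo H B A ∧ ContDiffOn ℝ ∞ H B ∧ (∀ y ∈ A, H (G y) = y) ∧ ∀ y ∈ B, G (H y) = y := by
  have hGz := hG.contDiffAt (hO.mem_nhds hz)
  have hd : HasFDerivAt G (e : E →L[ℝ] E) z := he ▸ (hGz.differentiableAt (by simp)).hasFDerivAt
  let f := hGz.toOpenPartialHomeomorph G hd (by simp)
  have hf : ∀ y, f y = G y := fun y => rfl
  have hzs : z ∈ f.source := hGz.mem_toOpenPartialHomeomorph_source hd (by simp)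
  obtain ⟨A, hAs, hA, hzA⟩ := mem_nhds_iff.1 (inter_mem (inter_mem (f.open_source.mem_nhds hzs)
    (hO.mem_nhds hz)) (eventually_range_equiv hO hz hG he))
  refine ⟨A, f.target ∩ f.symm ⁻¹' A, f.symm, hA, f.isOpen_inter_preimage_symm hA, hzA,
    fun y hy => (hAs hy).1.2, fun y hy => ?_, fun y hy => hy.2, fun y hy => ?_, fun y hy => ?_,
    fun y hy => ?_⟩
  · exact ⟨f.map_source (hAs hy).1.1, by
      rw [mem_preimage, ← hf, f.left_inv (hAs hy).1.1]; exact hy⟩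
  · obtain ⟨e', he'⟩ := (hAs hy.2).2
    have hs := hG.contDiffAt (hO.mem_nhds (hAs hy.2).1.2)
    exact (f.contDiffAt_symm hy.1 (he' ▸ (hs.differentiableAt (by simp)).hasFDerivAt)
      hs).contDiffWithinAt
  · rw [← hf, f.left_inv (hAs hy).1.1]
  · rw [← hf, f.right_inv hy.1]

/-- Along the flow of `V` the function `u` is deformed into a smooth one-parameter family of
functions `U (ε, ·)`, whose graphs are the images of the graph of `u`; the derivative in `ε` at
`ε = 0` is the characteristic of `V`. -/
theorem exists_deformation {D : Set (ℝ × Pt)} {Φ : ℝ → Pt → Pt} (hΦ : IsLocalFlow V D Φ)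
    (hu : ContDiff ℝ ∞ u) (hN : IsOpen N) (hNq : N ⊆ quadrant) (hq : q ∈ N) :
    ∃ (O : Set (ℝ × ℝ × ℝ)) (U : ℝ × ℝ × ℝ → ℝ), IsOpen O ∧ ((0 : ℝ), q) ∈ O ∧
      ContDiffOn ℝ ∞ U O ∧
      (∀ z ∈ O, z.2 ∈ quadrant ∧ ∃ p ∈ N, (z.1, (p.1, p.2, u p)) ∈ D ∧
        Φ z.1 (p.1, p.2, u p) = (z.2.1, z.2.2, U z)) ∧
      (∀ q, ((0 : ℝ), q) ∈ O → q ∈ N ∧ U (0, q) = u q ∧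
        fderiv ℝ U (0, q) (1, 0, 0) = characteristic α β V u q) := by
  let γ : ℝ × ℝ × ℝ → ℝ × Pt := fun z => (z.1, (z.2.1, z.2.2, u z.2))
  have hγ : ContDiff ℝ ∞ γ := by
    have := hu.comp (contDiff_snd (𝕜 := ℝ) (E := ℝ) (F := ℝ × ℝ))
    exact contDiff_fst.prodMk ((contDiff_fst.comp contDiff_snd).prodMk
      ((contDiff_snd.comp contDiff_snd).prodMk this))
  let O₁ : Set (ℝ × ℝ × ℝ) := γ ⁻¹' D ∩ {z | z.2 ∈ N}
  have hO₁ : IsOpen O₁ := (hΦ.isOpen.preimage hγ.continuous).inter (hN.preimage continuous_snd)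
  let Ψ : ℝ × ℝ × ℝ → Pt := fun z => Φ (γ z).1 (γ z).2
  have hΨ : ContDiffOn ℝ ∞ Ψ O₁ := hΦ.smooth.comp hγ.contDiffOn fun z hz => hz.1
  have mem0 : ∀ q ∈ N, ((0 : ℝ), q) ∈ O₁ := fun q hq => ⟨hΦ.zero_mem _ (hNq hq), hq⟩
  have hΨ0 : ∀ q ∈ N, Ψ (0, q) = (q.1, q.2, u q) := fun q hq => hΦ.init _ (hNq hq)
  have hΨd : ∀ q ∈ N, HasDerivAt (fun ε : ℝ => Ψ (ε, q)) (V (q.1, q.2, u q)) 0 := fun q hq => by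
    have h := hΦ.ode 0 (q.1, q.2, u q) (mem0 q hq).1
    rwa [show Φ 0 (q.1, q.2, u q) = (q.1, q.2, u q) from hΨ0 q hq] at h
  -- `G` tracks the base point of the moved graph. Inverting it near `(0, q)` expresses the moved
  -- `u`-coordinate as a function of the new `(t, x)`, smoothly in `ε`.
  let G : ℝ × ℝ × ℝ → ℝ × ℝ × ℝ := fun z => (z.1, (Ψ z).1, (Ψ z).2.1)
  have hG : ContDiffOn ℝ ∞ G O₁ := contDiffOn_fst.prodMk
    ((contDiff_fst.comp_contDiffOn hΨ).prodMk ((contDiff_fst.comp contDiff_snd).comp_contDiffOn hΨ))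
  have hG0 : ∀ q ∈ N, G (0, q) = (0, q) := fun q hq => by simp only [G, hΨ0 q hq]
  have hGd : ∀ q ∈ N, HasDerivAt (fun ε : ℝ => G (ε, q))
      (1, (V (q.1, q.2, u q)).1, (V (q.1, q.2, u q)).2.1) 0 := fun q hq =>
    (hasDerivAt_id _).prodMk ((hΨd q hq).fst.prodMk (hΨd q hq).snd.fst)
  have hGf : ∀ q ∈ N, DifferentiableAt ℝ G (0, q) := fun q hq =>
    hG.differentiableAt_of_isOpen hO₁ (mem0 q hq)
  have hGv : ∀ v : ℝ × ℝ, fderiv ℝ G (0, q) (0, v) = (0, v) := fun v => by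
    have h1 := (hGf q hq).hasFDerivAt.comp (f := fun q : ℝ × ℝ => ((0 : ℝ), q)) q
      (hasFDerivAt_prodMk_right 0 q)
    have h2 : HasFDerivAt (G ∘ fun q : ℝ × ℝ => ((0 : ℝ), q)) (ContinuousLinearMap.inr ℝ ℝ (ℝ × ℝ))
        q := (hasFDerivAt_prodMk_right 0 q).congr_of_eventuallyEq (by
      filter_upwards [hN.mem_nhds hq] with y hy
      exact hG0 y hy)
    have h3 := congr_arg (fun L => L v) (h1.unique h2)
    simpa using h3
  have hGε : fderiv ℝ G (0, q) (1, 0) = (1, (V (q.1, q.2, u q)).1, (V (q.1, q.2, u q)).2.1) :=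
    ((hGf q hq).hasFDerivAt.comp_hasDerivAt (f := fun ε : ℝ => (ε, q)) 0
      ((hasDerivAt_id _).prodMk (hasDerivAt_const _ _))).unique (hGd q hq)
  -- The derivative preserves the `ε`-component and is the identity on vectors `(0, v)`, hence is
  -- unipotent.
  have hinj : Function.Injective (fderiv ℝ G (0, q) : ℝ × ℝ × ℝ →ₗ[ℝ] ℝ × ℝ × ℝ) := by
    refine (injective_iff_map_eq_zero _).2 ?_
    rintro ⟨s, v⟩ h
    have e : ((s, v) : ℝ × ℝ × ℝ) = s • ((1 : ℝ), (0 : ℝ × ℝ)) + (0, v) := by simp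
    rw [e, map_add, map_smul] at h
    simp only [ContinuousLinearMap.coe_coe, hGε, hGv] at h
    have hs : s = 0 := by simpa using congr_arg Prod.fst h
    subst hs
    simpa using h
  let e : (ℝ × ℝ × ℝ) ≃L[ℝ] (ℝ × ℝ × ℝ) :=
    (LinearEquiv.ofInjectiveEndo _ hinj).toContinuousLinearEquiv
  have he : fderiv ℝ G (0, q) = (e : (ℝ × ℝ × ℝ) →L[ℝ] (ℝ × ℝ × ℝ)) := by
    refine ContinuousLinearMap.ext fun y => rfl
  obtain ⟨A, B, H, hA, hB, hqA, hAO, hGAB, hHBA, hH, hHG, hGH⟩ :=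
    exists_smooth_localInverse hO₁ (mem0 q hq) hG he
  have hO : IsOpen (A ∩ B) := hA.inter hB
  have hUs : ContDiffOn ℝ ∞ (fun z => (Ψ (H z)).2.2) B :=
    (contDiff_snd.comp contDiff_snd).comp_contDiffOn (hΨ.comp hH fun y hy => hAO (hHBA hy))
  have hU0 : ∀ q, ((0 : ℝ), q) ∈ A → (Ψ (H (0, q))).2.2 = u q := fun q hq => by
    have hqN : q ∈ N := (hAO hq).2
    have h1 := hHG _ hq
    rw [hG0 q hqN] at h1
    rw [h1, hΨ0 q hqN]
  refine ⟨A ∩ B, fun z => (Ψ (H z)).2.2, hO, ⟨hqA, ?_⟩, hUs.mono inter_subset_right, ?_, ?_⟩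
  · have := hGAB hqA
    rwa [hG0 q hq] at this
  · intro z hz
    have h1 := hAO (hHBA hz.2)
    have h2 := hGH z hz.2
    have h3 : (H z).1 = z.1 :=
      (congr_arg (fun y : ℝ × ℝ × ℝ => y.1) h2 : (G (H z)).1 = z.1)
    have h4 : (Ψ (H z)).1 = z.2.1 := congr_arg (fun y : ℝ × ℝ × ℝ => y.2.1) h2
    have h5 : (Ψ (H z)).2.1 = z.2.2 := congr_arg (fun y : ℝ × ℝ × ℝ => y.2.2) h2
    refine ⟨hNq (hAO hz.1).2, (H z).2, h1.2, ?_, ?_⟩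
    · rw [← h3]; exact h1.1
    · rw [← h4, ← h5, ← h3]
  · intro q hq
    have hqN : q ∈ N := (hAO hq.1).2
    refine ⟨hqN, hU0 q hq.1, ?_⟩
    have hUd := (hUs.mono inter_subset_right).differentiableAt_of_isOpen hO hq
    set U : ℝ × ℝ × ℝ → ℝ := fun z => (Ψ (H z)).2.2 with hU
    have hv : ∀ v : ℝ × ℝ, fderiv ℝ U (0, q) (0, v) = fderiv ℝ u q v := fun v => by
      rw [← fderiv_slice hUd]
      have hE : (fun q => U (0, q)) =ᶠ[𝓝 q] u := by
        filter_upwards [(isOpen_slice hO 0).mem_nhds hq] with y hy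
        exact hU0 y hy.1
      rw [hE.fderiv_eq]
    -- `U (G (ε, q))` is the `u`-coordinate of the moved point. Computing its derivative at `0` in
    -- two ways gives `U_ε + τ u_t + ξ u_x = η`.
    have h1 : HasDerivAt (fun ε : ℝ => U (G (ε, q))) (fderiv ℝ U (0, q)
        (1, (V (q.1, q.2, u q)).1, (V (q.1, q.2, u q)).2.1)) 0 :=
      HasFDerivAt.comp_hasDerivAt (l := U) (l' := fderiv ℝ U (0, q))
        (f := fun ε : ℝ => G (ε, q)) 0 (by rw [hG0 q hqN]; exact hUd.hasFDerivAt) (hGd q hqN)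
    have h2 : HasDerivAt (fun ε : ℝ => U (G (ε, q))) (V (q.1, q.2, u q)).2.2 0 := by
      refine HasDerivAt.congr_of_eventuallyEq (hΨd q hqN).snd.snd ?_
      have hc : Continuous fun ε : ℝ => (ε, q) := by fun_prop
      have hm : ∀ᶠ ε in 𝓝 (0 : ℝ), (ε, q) ∈ A := (hA.preimage hc).mem_nhds hq.1
      filter_upwards [hm] with ε hε
      simp only [hU, hHG _ hε]
    have h3 := h1.unique h2
    have e1 : ((1 : ℝ), (V (q.1, q.2, u q)).1, (V (q.1, q.2, u q)).2.1) =
      (1, 0, 0) + ((0 : ℝ), ((V (q.1, q.2, u q)).1 • ((1 : ℝ), (0 : ℝ)) +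
        (V (q.1, q.2, u q)).2.1 • ((0 : ℝ), (1 : ℝ)))) := by simp
    rw [e1, map_add, hv, map_add, map_smul, map_smul] at h3
    have r1 := rpow_sub_one_mul (hNq hqN).1 β
    have r2 := rpow_sub_one_mul (hNq hqN).2 α
    simp only [smul_eq_mul] at h3
    simp only [characteristic, along, etaC, xiC, tauC, wd]
    linear_combination h3 + fderiv ℝ u q (0, 1) * (V (q.1, q.2, u q)).2.1 * r2
      + fderiv ℝ u q (1, 0) * (V (q.1, q.2, u q)).1 * r1

theorem GeneratesSymmetry.waveCondition (hV : ContDiffOn ℝ ∞ V dom)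
    (h : GeneratesSymmetry α β V) : WaveCondition α β V := by
  obtain ⟨D, Φ, hΦ, hsym⟩ := h
  intro c u N hu hw q hq
  obtain ⟨O, U, hO, hqO, hU, hgraph, h0⟩ :=
    exists_deformation (α := α) (β := β) hΦ hu hw.isOpen hw.subset hq
  rw [← hw.linearizedOp_characteristic hV hq]
  refine linearizedOp_eq_zero_of_family hO (fun z hz => (hgraph z hz).1) hU (fun z hz => ?_)
    (fun q hq => (h0 q hq).2.1) (fun q hq => (h0 q hq).2.2) hqO
  exact (hsym z.1 u (fun q => U (z.1, q)) N {q | (z.1, q) ∈ O} hw.isSolutionOn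
    (isOpen_slice hO _) (contDiffOn_slice hU _) fun q hq => (hgraph _ hq).2).eqn z.2 hz

/-! ### The flows of the classified vector fields -/

/-- The integral of `exp (κ s)` over `0 ≤ s ≤ ε`. -/
def expInt (κ ε : ℝ) : ℝ := if κ = 0 then ε else (Real.exp (κ * ε) - 1) / κ

theorem expInt_zero (κ : ℝ) : expInt κ 0 = 0 := by simp [expInt]

theorem contDiff_expInt (κ : ℝ) : ContDiff ℝ ∞ (expInt κ) := by
  unfold expInt
  split_ifs
  · exact contDiff_id
  · fun_prop

theorem hasDerivAt_expInt (κ ε : ℝ) : HasDerivAt (expInt κ) (Real.exp (κ * ε)) ε := by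
  unfold expInt
  split_ifs with h
  · simpa [h] using hasDerivAt_id' ε
  · have h1 : HasDerivAt (fun ε : ℝ => κ * ε) κ ε := by simpa using (hasDerivAt_id ε).const_mul κ
    refine ((h1.exp.sub_const 1).div_const κ).congr_deriv ?_
    field_simp

theorem monotone_expInt (κ : ℝ) : Monotone (expInt κ) :=
  monotone_of_deriv_nonneg (fun ε => (hasDerivAt_expInt κ ε).differentiableAt) fun ε => by
    rw [(hasDerivAt_expInt κ ε).deriv]; positivity

/-- The expression is monotone or antitone in `ε` according to the sign of `m`, so its positivity
set is an interval. -/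
theorem ordConnected_add_expInt_pos (a m κ : ℝ) :
    {ε : ℝ | 0 < a + m * expInt κ ε}.OrdConnected := by
  refine ⟨fun x hx y hy ε hε => ?_⟩
  have h1 := monotone_expInt κ hε.1
  have h2 := monotone_expInt κ hε.2
  simp only [mem_ofPred_eq] at hx hy ⊢
  rcases le_total 0 m with hm | hm
  · nlinarith
  · nlinarith

/-- The flow of `(-κ s + m s ^ (1 - r)) / r ∂/∂s` on the half-line. -/
def lineFlow (r κ m ε s : ℝ) : ℝ := (Real.exp (-κ * ε) * (s ^ r + m * expInt κ ε)) ^ r⁻¹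

/-- The inverse of the flow `lineFlow`. -/
def lineFlowInv (r κ m ε s : ℝ) : ℝ := (Real.exp (κ * ε) * s ^ r - m * expInt κ ε) ^ r⁻¹

section LineFlow

variable {r κ m ε s : ℝ}

theorem lineFlow_pos (h : 0 < s ^ r + m * expInt κ ε) : 0 < lineFlow r κ m ε s :=
  Real.rpow_pos_of_pos (mul_pos (Real.exp_pos _) h) _

theorem lineFlow_zero (hr : r ≠ 0) (hs : 0 < s) : lineFlow r κ m 0 s = s := by
  simp [lineFlow, expInt_zero, Real.rpow_rpow_inv hs.le hr]

theorem exp_mul_lineFlow_rpow (hr : r ≠ 0) (h : 0 < s ^ r + m * expInt κ ε) :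
    Real.exp (κ * ε) * lineFlow r κ m ε s ^ r - m * expInt κ ε = s ^ r := by
  rw [lineFlow, Real.rpow_inv_rpow (mul_pos (Real.exp_pos _) h).le hr, ← mul_assoc, ← Real.exp_add]
  simp

theorem lineFlowInv_lineFlow (hr : r ≠ 0) (hs : 0 < s) (h : 0 < s ^ r + m * expInt κ ε) :
    lineFlowInv r κ m ε (lineFlow r κ m ε s) = s := by
  rw [lineFlowInv, exp_mul_lineFlow_rpow hr h, Real.rpow_rpow_inv hs.le hr]

theorem rpow_inv_sub_one {S : ℝ} (hr : r ≠ 0) (hS : 0 < S) :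
    S ^ (r⁻¹ - 1) = (S ^ r⁻¹) ^ (1 - r) := by
  rw [← Real.rpow_mul hS.le]
  congr 1
  field_simp

/-- In the variable `S = s ^ r` the equation is the affine one `S' = -κ S + m`, solved by variation
of constants. -/
theorem hasDerivAt_lineFlow (hr : r ≠ 0) (h : 0 < s ^ r + m * expInt κ ε) :
    HasDerivAt (fun ε => lineFlow r κ m ε s)
      (-κ / r * lineFlow r κ m ε s + m / r * lineFlow r κ m ε s ^ (1 - r)) ε := by
  have hS : 0 < Real.exp (-κ * ε) * (s ^ r + m * expInt κ ε) := mul_pos (Real.exp_pos _) h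
  have h1 : HasDerivAt (fun ε : ℝ => -κ * ε) (-κ) ε := by
    simpa using (hasDerivAt_id ε).const_mul (-κ)
  have h2 := (h1.exp.mul (((hasDerivAt_expInt κ ε).const_mul m).const_add (s ^ r))).rpow_const
    (p := r⁻¹) (Or.inl hS.ne')
  refine h2.congr_deriv ?_
  have e1 : Real.exp (-κ * ε) * Real.exp (κ * ε) = 1 := by rw [← Real.exp_add]; simp
  have e2 := Real.rpow_sub_one hS.ne' r⁻¹
  have e3 := rpow_inv_sub_one hr hS
  simp only [lineFlow]
  rw [← e3]
  have e4 : (Real.exp (-κ * ε) * (s ^ r + m * expInt κ ε)) ^ r⁻¹ =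
      (Real.exp (-κ * ε) * (s ^ r + m * expInt κ ε)) ^ (r⁻¹ - 1) *
        (Real.exp (-κ * ε) * (s ^ r + m * expInt κ ε)) := by
    rw [e2]; field_simp
  simp only [Pi.mul_apply] at *
  rw [e4]
  linear_combination r⁻¹ * m *
    (Real.exp (-κ * ε) * (s ^ r + m * expInt κ ε)) ^ (r⁻¹ - 1) * e1

theorem hasDerivAt_lineFlowInv (hr : r ≠ 0) (hs : 0 < s)
    (h : 0 < Real.exp (κ * ε) * s ^ r - m * expInt κ ε) :
    HasDerivAt (lineFlowInv r κ m ε)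
      (Real.exp (κ * ε) * lineFlowInv r κ m ε s ^ (1 - r) * s ^ (r - 1)) s := by
  have h1 := (((Real.hasDerivAt_rpow_const (p := r) (Or.inl hs.ne')).const_mul
    (Real.exp (κ * ε))).sub_const (m * expInt κ ε)).rpow_const (p := r⁻¹) (Or.inl h.ne')
  refine h1.congr_deriv ?_
  rw [rpow_inv_sub_one hr h, lineFlowInv]
  field_simp

end LineFlow

/-! ### Action of the flows on the equation. -/

/-- The change of variables inverse to the flow of a classified vector field on the plane. -/
def planeFlowInv (α β κ₁ κ₂ m₁ m₂ ε : ℝ) (q : ℝ × ℝ) : ℝ × ℝ :=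
  (lineFlowInv β κ₁ m₁ ε q.1, lineFlowInv α κ₂ m₂ ε q.2)

section PlaneFlow

variable {κ₁ κ₂ m₁ m₂ ε : ℝ} {W : Set (ℝ × ℝ)}

/-- In `x ^ α` the inverse flow is affine with slope `exp (κ₂ ε)`, so it rescales the conformable
derivative by that constant. -/
theorem fracX_comp_planeFlowInv (hα : α ≠ 0) (hq : q ∈ quadrant)
    (h : 0 < Real.exp (κ₂ * ε) * q.2 ^ α - m₂ * expInt κ₂ ε)
    (hf : DifferentiableAt ℝ f (planeFlowInv α β κ₁ κ₂ m₁ m₂ ε q)) :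
    fracX α (fun q => f (planeFlowInv α β κ₁ κ₂ m₁ m₂ ε q)) q =
      Real.exp (κ₂ * ε) * δx α f (planeFlowInv α β κ₁ κ₂ m₁ m₂ ε q) := by
  have h1 := (hasDerivAt_const q.2 (lineFlowInv β κ₁ m₁ ε q.1)).prodMk
    (hasDerivAt_lineFlowInv hα hq.2 h)
  have h2 := HasFDerivAt.comp_hasDerivAt (l := f) q.2 hf.hasFDerivAt h1
  rw [fracX_eq, px]
  refine (congr_arg _ h2.deriv).trans ?_
  rw [show ((0 : ℝ), Real.exp (κ₂ * ε) * lineFlowInv α κ₂ m₂ ε q.2 ^ (1 - α) * q.2 ^ (α - 1)) =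
    (Real.exp (κ₂ * ε) * lineFlowInv α κ₂ m₂ ε q.2 ^ (1 - α) * q.2 ^ (α - 1)) • (0, 1) by simp,
    map_smul, wd, smul_eq_mul]
  have r1 := rpow_sub_one_mul hq.2 α
  simp only [planeFlowInv]
  linear_combination Real.exp (κ₂ * ε) * lineFlowInv α κ₂ m₂ ε q.2 ^ (1 - α) *
    fderiv ℝ f (lineFlowInv β κ₁ m₁ ε q.1, lineFlowInv α κ₂ m₂ ε q.2) (0, 1) * r1

theorem fracT_comp_planeFlowInv (hβ : β ≠ 0) (hq : q ∈ quadrant)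
    (h : 0 < Real.exp (κ₁ * ε) * q.1 ^ β - m₁ * expInt κ₁ ε)
    (hf : DifferentiableAt ℝ f (planeFlowInv α β κ₁ κ₂ m₁ m₂ ε q)) :
    fracT β (fun q => f (planeFlowInv α β κ₁ κ₂ m₁ m₂ ε q)) q =
      Real.exp (κ₁ * ε) * δt β f (planeFlowInv α β κ₁ κ₂ m₁ m₂ ε q) := by
  have h1 := (hasDerivAt_lineFlowInv hβ hq.1 h).prodMk
    (hasDerivAt_const q.1 (lineFlowInv α κ₂ m₂ ε q.2))
  have h2 := HasFDerivAt.comp_hasDerivAt (l := f) q.1 hf.hasFDerivAt h1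
  rw [fracT_eq, pt]
  refine (congr_arg _ h2.deriv).trans ?_
  rw [show (Real.exp (κ₁ * ε) * lineFlowInv β κ₁ m₁ ε q.1 ^ (1 - β) * q.1 ^ (β - 1), (0 : ℝ)) =
    (Real.exp (κ₁ * ε) * lineFlowInv β κ₁ m₁ ε q.1 ^ (1 - β) * q.1 ^ (β - 1)) • (1, 0) by simp,
    map_smul, wd, smul_eq_mul]
  have r1 := rpow_sub_one_mul hq.1 β
  simp only [planeFlowInv]
  linear_combination Real.exp (κ₁ * ε) * lineFlowInv β κ₁ m₁ ε q.1 ^ (1 - β) *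
    fderiv ℝ f (lineFlowInv β κ₁ m₁ ε q.1, lineFlowInv α κ₂ m₂ ε q.2) (1, 0) * r1

theorem fracX_const_mul (c : ℝ) : fracX α (fun q => c * f q) q = c * fracX α f q := by
  rw [fracX_eq, fracX_eq, px, px, deriv_const_mul_field]; ring

theorem fracT_const_mul (c : ℝ) : fracT β (fun q => c * f q) q = c * fracT β f q := by
  rw [fracT_eq, fracT_eq, pt, pt, deriv_const_mul_field]; ring

/-- Each `x`-derivative contributes a factor `c`, the `t`-derivative `c ^ 3` because `κ₁ = 3 κ₂`,
and `u` itself `c`; hence all three terms have weight `4`. -/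
theorem mkdvOp_comp_planeFlowInv (hα : α ≠ 0) (hβ : β ≠ 0) {u' : ℝ × ℝ → ℝ} {c : ℝ}
    (hκ : κ₁ = 3 * κ₂) (hc : c = Real.exp (κ₂ * ε)) (hN : IsOpen N) (hNq : N ⊆ quadrant)
    (hW : IsOpen W) (hWq : W ⊆ quadrant) (hu : ContDiffOn ℝ ∞ u W)
    (hmem : ∀ q ∈ N, planeFlowInv α β κ₁ κ₂ m₁ m₂ ε q ∈ W)
    (h1 : ∀ q ∈ N, 0 < Real.exp (κ₁ * ε) * q.1 ^ β - m₁ * expInt κ₁ ε)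
    (h2 : ∀ q ∈ N, 0 < Real.exp (κ₂ * ε) * q.2 ^ α - m₂ * expInt κ₂ ε)
    (hu' : ∀ q ∈ N, u' q = c * u (planeFlowInv α β κ₁ κ₂ m₁ m₂ ε q)) (hq : q ∈ N) :
    mkdvOp α β u' q = c ^ 4 * mkdvOp α β u (planeFlowInv α β κ₁ κ₂ m₁ m₂ ε q) := by
  have hs : ∀ {f : ℝ × ℝ → ℝ}, ContDiffOn ℝ ∞ f W → ContDiffOn ℝ ∞ (δx α f) W :=
    contDiffOn_δx hW hWq
  have step : ∀ {f g : ℝ × ℝ → ℝ} {d : ℝ}, ContDiffOn ℝ ∞ f W →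
      EqOn g (fun q => d * f (planeFlowInv α β κ₁ κ₂ m₁ m₂ ε q)) N →
      EqOn (fracX α g) (fun q => d * c * δx α f (planeFlowInv α β κ₁ κ₂ m₁ m₂ ε q)) N :=
    fun hf hg q hq => by
      rw [fracX_congr hN hg hq, fracX_const_mul, fracX_comp_planeFlowInv hα (hNq hq) (h2 q hq)
        (hf.differentiableAt_of_isOpen hW (hmem q hq)), hc]
      ring
  have e1 := step hu hu'
  have e2 := step (hs hu) e1
  have e3 := step (hs (hs hu)) e2
  have et : fracT β u' q = c * (c ^ 3 * δt β u (planeFlowInv α β κ₁ κ₂ m₁ m₂ ε q)) := by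
    have : fracT β u' q = fracT β (fun q => c * u (planeFlowInv α β κ₁ κ₂ m₁ m₂ ε q)) q := by
      rw [fracT_eq, fracT_eq, pt_congr hN hu' hq]
    rw [this, fracT_const_mul, fracT_comp_planeFlowInv hβ (hNq hq) (h1 q hq)
      (hu.differentiableAt_of_isOpen hW (hmem q hq)), hκ, hc, ← Real.exp_nat_mul]
    congr 3
    push_cast
    ring
  rw [mkdvOp, et, e1 hq, e3 hq, hu' q hq, mkdvOp_eqOn hW hWq hu (hmem q hq)]
  ring

end PlaneFlow

theorem IsClassified.generatesSymmetry (hα : α ≠ 0) (hβ : β ≠ 0) (h : IsClassified α β V) :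
    GeneratesSymmetry α β V := by
  obtain ⟨c₁, c₂, c₃, hV⟩ := h
  let I₁ : ℝ × Pt → ℝ := fun z => z.2.1 ^ β + β * c₂ * expInt (3 * c₁) z.1
  let I₂ : ℝ × Pt → ℝ := fun z => z.2.2.1 ^ α + α * c₃ * expInt c₁ z.1
  let D₀ : Set (ℝ × Pt) := {z | z.2 ∈ dom}
  have hD₀ : IsOpen D₀ := isOpen_dom.preimage continuous_snd
  have hI₁ : ContDiffOn ℝ ∞ I₁ D₀ :=
    ((contDiffOn_dom_rpow_fst β).comp contDiffOn_snd fun z hz => hz).add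
      (contDiffOn_const.mul ((contDiff_expInt _).comp_contDiffOn contDiffOn_fst))
  have hI₂ : ContDiffOn ℝ ∞ I₂ D₀ :=
    ((contDiffOn_dom_rpow_snd α).comp contDiffOn_snd fun z hz => hz).add
      (contDiffOn_const.mul ((contDiff_expInt _).comp_contDiffOn contDiffOn_fst))
  -- The flow exists as long as the affine expressions for `t ^ β` and `x ^ α` stay positive.
  let D : Set (ℝ × Pt) := (D₀ ∩ I₁ ⁻¹' Ioi 0) ∩ (D₀ ∩ I₂ ⁻¹' Ioi 0)
  let Φ : ℝ → Pt → Pt := fun ε p => (lineFlow β (3 * c₁) (β * c₂) ε p.1,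
    lineFlow α c₁ (α * c₃) ε p.2.1, Real.exp (c₁ * ε) * p.2.2)
  have hmaps : ∀ ε p, (ε, p) ∈ D → Φ ε p ∈ dom := fun ε p hp =>
    ⟨lineFlow_pos hp.1.2, lineFlow_pos hp.2.2⟩
  have hflow : IsLocalFlow V D Φ :=
    { isOpen := (hI₁.continuousOn.isOpen_inter_preimage hD₀ isOpen_Ioi).inter
        (hI₂.continuousOn.isOpen_inter_preimage hD₀ isOpen_Ioi)
      subset := fun ε p hp => hp.1.1
      zero_mem := fun p hp => by
        have h1 := Real.rpow_pos_of_pos hp.1 β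
        have h2 := Real.rpow_pos_of_pos hp.2 α
        refine ⟨⟨hp, ?_⟩, ⟨hp, ?_⟩⟩
        · simpa [I₁, expInt_zero] using h1
        · simpa [I₂, expInt_zero] using h2
      interval := fun p => by
        by_cases hp : p ∈ dom
        · have : {ε : ℝ | (ε, p) ∈ D} = {ε | 0 < p.1 ^ β + β * c₂ * expInt (3 * c₁) ε} ∩
              {ε | 0 < p.2.1 ^ α + α * c₃ * expInt c₁ ε} := by
            ext ε
            simp [D, D₀, I₁, I₂, hp]
          rw [this]
          exact (ordConnected_add_expInt_pos _ _ _).inter (ordConnected_add_expInt_pos _ _ _)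
        · have : {ε : ℝ | (ε, p) ∈ D} = ∅ := by
            ext ε
            simp [D, D₀, hp]
          rw [this]
          exact ordConnected_empty
      mapsTo := hmaps
      smooth := by
        have e : ∀ κ : ℝ, ContDiffOn ℝ ∞ (fun z : ℝ × Pt => Real.exp (κ * z.1)) D := fun κ => by
          fun_prop
        refine ContDiffOn.prodMk ?_ (ContDiffOn.prodMk ?_ ?_)
        · exact ((e _).mul (hI₁.mono fun z hz => hz.1.1)).rpow_const_of_ne fun z hz =>
            (mul_pos (Real.exp_pos _) hz.1.2).ne'
        · exact ((e _).mul (hI₂.mono fun z hz => hz.1.1)).rpow_const_of_ne fun z hz =>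
            (mul_pos (Real.exp_pos _) hz.2.2).ne'
        · exact (e _).mul (contDiff_snd.comp (contDiff_snd.comp contDiff_snd)).contDiffOn
      init := fun p hp => by
        simp only [Φ, lineFlow_zero hβ hp.1, lineFlow_zero hα hp.2]
        simp
      ode := fun ε p hp => by
        have hm := hmaps ε p hp
        have h1 := hasDerivAt_lineFlow (κ := 3 * c₁) (m := β * c₂) hβ hp.1.2
        have h2 := hasDerivAt_lineFlow (κ := c₁) (m := α * c₃) hα hp.2.2
        have h3 : HasDerivAt (fun ε : ℝ => c₁ * ε) c₁ ε := by
          simpa using (hasDerivAt_id ε).const_mul c₁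
        refine (h1.prodMk (h2.prodMk (h3.exp.mul_const p.2.2))).congr_deriv ?_
        rw [show Φ ε p = ((Φ ε p).1, (Φ ε p).2.1, (Φ ε p).2.2) from rfl, hV _ _ _ hm.1 hm.2]
        refine Prod.ext ?_ (Prod.ext ?_ ?_)
        · simp only [Φ]
          field_simp
        · simp only [Φ]
          field_simp
        · simp only [Φ]
          ring }
  refine ⟨D, Φ, hflow, fun ε u u' W W' hu hW' hu' hgr => ?_⟩
  have hgr' : ∀ q ∈ W', q ∈ quadrant ∧ planeFlowInv α β (3 * c₁) c₁ (β * c₂) (α * c₃) ε q ∈ W ∧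
      0 < Real.exp (3 * c₁ * ε) * q.1 ^ β - β * c₂ * expInt (3 * c₁) ε ∧
      0 < Real.exp (c₁ * ε) * q.2 ^ α - α * c₃ * expInt c₁ ε ∧
      u' q = Real.exp (c₁ * ε) *
        u (planeFlowInv α β (3 * c₁) c₁ (β * c₂) (α * c₃) ε q) := by
    intro q hq
    obtain ⟨p, hp, hpD, hpq⟩ := hgr q hq
    have hm := hmaps _ _ hpD
    rw [hpq] at hm
    have hpd : p ∈ quadrant := hpD.1.1
    have q1 : lineFlow β (3 * c₁) (β * c₂) ε p.1 = q.1 := congr_arg (fun y : Pt => y.1) hpq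
    have q2 : lineFlow α c₁ (α * c₃) ε p.2 = q.2 := congr_arg (fun y : Pt => y.2.1) hpq
    have q3 : Real.exp (c₁ * ε) * u p = u' q := congr_arg (fun y : Pt => y.2.2) hpq
    have hP : planeFlowInv α β (3 * c₁) c₁ (β * c₂) (α * c₃) ε q = p := by
      rw [planeFlowInv, ← q1, ← q2, lineFlowInv_lineFlow hβ hpd.1 hpD.1.2,
        lineFlowInv_lineFlow hα hpd.2 hpD.2.2]
    refine ⟨hm, hP ▸ hp, ?_, ?_, ?_⟩
    · rw [← q1, exp_mul_lineFlow_rpow hβ hpD.1.2]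
      exact Real.rpow_pos_of_pos hpd.1 _
    · rw [← q2, exp_mul_lineFlow_rpow hα hpD.2.2]
      exact Real.rpow_pos_of_pos hpd.2 _
    · rw [hP, q3]
  exact
    { isOpen := hW'
      subset := fun q hq => (hgr' q hq).1
      smooth := hu'
      eqn := fun q hq => by
        rw [mkdvOp_comp_planeFlowInv hα hβ rfl rfl hW' (fun q hq => (hgr' q hq).1) hu.isOpen
          hu.subset hu.smooth (fun q hq => (hgr' q hq).2.1) (fun q hq => (hgr' q hq).2.2.1)
          (fun q hq => (hgr' q hq).2.2.2.1) (fun q hq => (hgr' q hq).2.2.2.2) hq,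
          hu.eqn _ (hgr' q hq).2.1, mul_zero] }

/-! ### The main theorem -/

theorem tfae_symmetry (hα : α ≠ 0) (hβ : β ≠ 0) (hV : ContDiffOn ℝ ∞ V dom) :
    [GeneratesSymmetry α β V, LieCondition α β V, IsClassified α β V].TFAE := by
  tfae_have 1 → 3 := fun h => (h.waveCondition hV).isClassified hα hβ hV
  tfae_have 2 → 3 := fun h => (h.waveCondition hV).isClassified hα hβ hV
  tfae_have 3 → 1 := fun h => h.generatesSymmetry hα hβ
  tfae_have 3 → 2 := fun h => h.lieCondition hα hβ
  tfae_finish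

/-! ### Span, linear independence, brackets and the classical case. -/

theorem sum_smul_basisField (c : Fin 3 → ℝ) (p : Pt) :
    ∑ i, c i • basisField α β i p =
      (c 0 * p.1 ^ (1 - β) + c 2 * (3 * p.1 / β), c 1 * p.2.1 ^ (1 - α) + c 2 * (p.2.1 / α),
        -(c 2 * p.2.2)) := by
  simp [Fin.sum_univ_three, basisField]

theorem isClassified_iff_exists_sum : IsClassified α β V ↔
    ∃ c : Fin 3 → ℝ, ∀ p ∈ dom, V p = ∑ i, c i • basisField α β i p := by
  constructor
  · rintro ⟨c₁, c₂, c₃, h⟩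
    -- The sign comes from the `-u` in the third basis field.
    refine ⟨![c₂, c₃, -c₁], fun p hp => ?_⟩
    rw [sum_smul_basisField, show V p = V (p.1, p.2.1, p.2.2) from rfl, h _ _ _ hp.1 hp.2]
    simp only [Matrix.cons_val]
    refine Prod.ext ?_ (Prod.ext ?_ ?_) <;> ring
  · rintro ⟨c, h⟩
    refine ⟨-c 2, c 0, c 1, fun t x u ht hx => ?_⟩
    rw [h (t, x, u) ⟨ht, hx⟩, sum_smul_basisField]
    refine Prod.ext ?_ (Prod.ext ?_ ?_) <;> ring

theorem contDiffOn_basisField (i : Fin 3) : ContDiffOn ℝ ∞ (basisField α β i) dom := by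
  have h1 := contDiffOn_dom_rpow_fst (1 - β)
  have h2 := contDiffOn_dom_rpow_snd (1 - α)
  fin_cases i
  · exact h1.prodMk contDiffOn_const
  · exact contDiffOn_const.prodMk (h2.prodMk contDiffOn_const)
  · exact ContDiff.contDiffOn (f := fun p : Pt => (3 * p.1 / β, p.2.1 / α, -p.2.2)) (by fun_prop)

/-- Fields are compared after restriction, since their values off `dom` are arbitrary. -/
theorem generators_eq_span (hα : α ≠ 0) (hβ : β ≠ 0) :
    {X : dom → Pt | ∃ V : Pt → Pt, ContDiffOn ℝ ∞ V dom ∧ GeneratesSymmetry α β V ∧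
      dom.domRestrict V = X} =
    (Submodule.span ℝ (Set.range fun i : Fin 3 => dom.domRestrict (basisField α β i)) :
      Set (dom → Pt)) := by
  ext X
  rw [SetLike.mem_coe, Submodule.mem_span_range_iff_exists_fun]
  constructor
  · rintro ⟨V, hV, hs, rfl⟩
    obtain ⟨c, hc⟩ := isClassified_iff_exists_sum.1 (((tfae_symmetry hα hβ hV).out 0 2).1 hs)
    refine ⟨c, ?_⟩
    ext1 p
    rw [Finset.sum_apply]
    exact (hc p p.2).symm
  · rintro ⟨c, rfl⟩
    refine ⟨fun p => ∑ i, c i • basisField α β i p, ContDiffOn.sum fun i _ =>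
      (contDiffOn_basisField i).const_smul (c i),
      (isClassified_iff_exists_sum.2 ⟨c, fun p _ => rfl⟩).generatesSymmetry hα hβ, ?_⟩
    ext1 p
    rw [Finset.sum_apply]
    rfl

theorem linearIndependent_basisField :
    LinearIndependent ℝ (fun i : Fin 3 => dom.domRestrict (basisField α β i)) := by
  rw [Fintype.linearIndependent_iff]
  intro c hc
  have h : ∀ p ∈ dom, ∑ i, c i • basisField α β i p = 0 := fun p hp => by
    have := congr_fun hc ⟨p, hp⟩
    rwa [Finset.sum_apply] at this
  -- A single point suffices: the `u`-component isolates `c 2`, and then the other components give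
  -- `c 0` and `c 1`.
  have h1 := h (1, 1, 1) ⟨one_pos, one_pos⟩
  rw [sum_smul_basisField] at h1
  simp only [Prod.mk_eq_zero, Real.one_rpow] at h1
  obtain ⟨e1, e2, e3⟩ := h1
  have h2 : c 2 = 0 := by linarith
  rw [h2] at e1 e2
  intro i
  fin_cases i
  · simpa using e1
  · simpa using e2
  · exact h2

theorem fderiv_basisField_zero {p : Pt} (hp : p ∈ dom) (v : Pt) :
    fderiv ℝ (basisField α β 0) p v = ((1 - β) * p.1 ^ (-β) * v.1, 0, 0) := by
  have h1 := (contDiffOn_dom_rpow_fst (1 - β)).differentiableAt_of_isOpen isOpen_dom hp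
  have h := h1.hasFDerivAt.prodMk (hasFDerivAt_const ((0 : ℝ), (0 : ℝ)) p)
  refine (congr_arg (fun L => L v) h.fderiv).trans ?_
  simp only [ContinuousLinearMap.prod_apply, fderiv_dom_rpow_fst hp]
  simp [show (1 - β - 1) = -β by ring, Prod.zero_eq_mk]

theorem fderiv_basisField_one {p : Pt} (hp : p ∈ dom) (v : Pt) :
    fderiv ℝ (basisField α β 1) p v = (0, (1 - α) * p.2.1 ^ (-α) * v.2.1, 0) := by
  have h1 := (contDiffOn_dom_rpow_snd (1 - α)).differentiableAt_of_isOpen isOpen_dom hp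
  have h := (hasFDerivAt_const (0 : ℝ) p).prodMk
    (h1.hasFDerivAt.prodMk (hasFDerivAt_const (0 : ℝ) p))
  refine (congr_arg (fun L => L v) h.fderiv).trans ?_
  simp only [ContinuousLinearMap.prod_apply, fderiv_dom_rpow_snd hp]
  simp [show (1 - α - 1) = -α by ring]

theorem fderiv_basisField_two (p v : Pt) :
    fderiv ℝ (basisField α β 2) p v = (3 * v.1 / β, v.2.1 / α, -v.2.2) := by
  let L : Pt →ₗ[ℝ] Pt :=
    { toFun := basisField α β 2
      map_add' := fun x y => by
        refine Prod.ext ?_ (Prod.ext ?_ ?_) <;> simp [basisField] <;> ring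
      map_smul' := fun c x => by
        refine Prod.ext ?_ (Prod.ext ?_ ?_) <;> simp [basisField] <;> ring }
  exact congr_arg (fun L => L v) (LinearMap.toContinuousLinearMap L).fderiv

theorem lieBracket_basisField (hα : α ≠ 0) (hβ : β ≠ 0) {p : Pt} (hp : p ∈ dom) :
    VectorField.lieBracket ℝ (basisField α β 0) (basisField α β 1) p = 0 ∧
    VectorField.lieBracket ℝ (basisField α β 0) (basisField α β 2) p =
      (3 : ℝ) • basisField α β 0 p ∧
    VectorField.lieBracket ℝ (basisField α β 1) (basisField α β 2) p = basisField α β 1 p := by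
  have h1 : p.1 ^ (1 - β) = p.1 * p.1 ^ (-β) := by
    rw [sub_eq_add_neg, Real.rpow_add hp.1, Real.rpow_one]
  have h2 : p.2.1 ^ (1 - α) = p.2.1 * p.2.1 ^ (-α) := by
    rw [sub_eq_add_neg, Real.rpow_add hp.2, Real.rpow_one]
  simp only [VectorField.lieBracket_eq, fderiv_basisField_zero hp, fderiv_basisField_one hp,
    fderiv_basisField_two]
  refine ⟨?_, ?_, ?_⟩
  · simp [basisField]
  · simp only [basisField, Matrix.cons_val]
    refine Prod.ext ?_ (Prod.ext ?_ ?_)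
    · simp only [h1, Prod.fst_sub, Prod.smul_fst, smul_eq_mul]
      field_simp
      ring
    · simp
    · simp
  · simp only [basisField, Matrix.cons_val]
    refine Prod.ext ?_ (Prod.ext ?_ ?_)
    · simp
    · simp only [h2, Prod.fst_sub, Prod.snd_sub]
      field_simp
      ring
    · simp

/-- The weights are zeroth powers, equal to `1` everywhere, so neither positivity nor smoothness is
needed. -/
theorem mkdvOp_one_one (u : ℝ × ℝ → ℝ) (t x : ℝ) : mkdvOp 1 1 u (t, x) =
    deriv (fun s => u (s, x)) t - 6 * u (t, x) ^ 2 * deriv (fun y => u (t, y)) x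
      + iteratedDeriv 3 (fun y => u (t, y)) x := by
  have hX : ∀ f : ℝ × ℝ → ℝ, fracX 1 f = px f := fun f => by
    ext p; simp [fracX_eq]
  rw [mkdvOp, hX, hX, hX, fracT_eq]
  simp only [iteratedDeriv_succ, iteratedDeriv_zero]
  simp [px, pt]

end FracMKdV

end

theorem mainTheorem2 (α β : ℝ) (hα : 0 < α) (hα1 : α ≤ 1) (hβ : 0 < β) (hβ1 : β ≤ 1) :
    -- the infinitesimal generators of symmetries
    (∀ V : FracMKdV.Pt → FracMKdV.Pt, ContDiffOn ℝ ∞ V FracMKdV.dom →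
      [FracMKdV.GeneratesSymmetry α β V,
        FracMKdV.LieCondition α β V,
        ∃ c₁ c₂ c₃ : ℝ, ∀ t x u : ℝ, 0 < t → 0 < x →
          V (t, x, u) =
            (-3 * c₁ / β * t + c₂ * t ^ (1 - β), -c₁ / α * x + c₃ * x ^ (1 - α), c₁ * u)].TFAE) ∧
    -- they form the space spanned by `V₁, V₂, V₃`, which has dimension three
    {X : FracMKdV.dom → FracMKdV.Pt | ∃ V : FracMKdV.Pt → FracMKdV.Pt,
        ContDiffOn ℝ ∞ V FracMKdV.dom ∧ FracMKdV.GeneratesSymmetry α β V ∧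
          FracMKdV.dom.domRestrict V = X} =
      (Submodule.span ℝ (Set.range fun i : Fin 3 =>
        FracMKdV.dom.domRestrict (FracMKdV.basisField α β i)) : Set (FracMKdV.dom → FracMKdV.Pt)) ∧
    LinearIndependent ℝ (fun i : Fin 3 => FracMKdV.dom.domRestrict (FracMKdV.basisField α β i)) ∧
    -- the Lie brackets
    (∀ p ∈ FracMKdV.dom,
      VectorField.lieBracket ℝ (FracMKdV.basisField α β 0) (FracMKdV.basisField α β 1) p = 0 ∧
      VectorField.lieBracket ℝ (FracMKdV.basisField α β 0) (FracMKdV.basisField α β 2) p =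
        (3 : ℝ) • FracMKdV.basisField α β 0 p ∧
      VectorField.lieBracket ℝ (FracMKdV.basisField α β 1) (FracMKdV.basisField α β 2) p =
        FracMKdV.basisField α β 1 p) ∧
    -- the classical case
    (α = 1 → β = 1 →
      (∀ (u : ℝ × ℝ → ℝ) (t x : ℝ), FracMKdV.mkdvOp α β u (t, x) =
        deriv (fun s => u (s, x)) t - 6 * u (t, x) ^ 2 * deriv (fun y => u (t, y)) x
          + iteratedDeriv 3 (fun y => u (t, y)) x) ∧
      ∀ t x u : ℝ,
        FracMKdV.basisField α β 0 (t, x, u) = (1, 0, 0) ∧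
        FracMKdV.basisField α β 1 (t, x, u) = (0, 1, 0) ∧
        FracMKdV.basisField α β 2 (t, x, u) = (3 * t, x, -u)) := by
  have hα0 := hα.ne'
  have hβ0 := hβ.ne'
  refine ⟨fun V hV => FracMKdV.tfae_symmetry hα0 hβ0 hV, FracMKdV.generators_eq_span hα0 hβ0,
    FracMKdV.linearIndependent_basisField,
    fun p hp => FracMKdV.lieBracket_basisField hα0 hβ0 hp, ?_⟩
  rintro rfl rfl
  refine ⟨FracMKdV.mkdvOp_one_one, fun t x u => ?_⟩
  simp [FracMKdV.basisField]
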